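/- **Theorem (degenerate limit of the screening currents).** Let $\beta\in\mathbb{C}\setminus\{0\}$ and fix square roots $\sqrt\beta$ and $\sqrt{-2}$. *Heisenberg algebra.* Let $a_n,\tilde a_n$ ($n\in\mathbb{Z}$), $Q,\tilde Q$ be generators with $[a_n,a_m]=[\tilde a_n,\tilde a_m]=n\delta_{n+m,0}$, $[a_n,Q]=[\tilde a_n,\tilde Q]=\delta_{n,0}$, all other commutators being zero. They act (with $Q,\tilde Q$ acting through $e^{xQ+y\tilde Q}:|u,v\rangle\mapsto|u+x,v+y\rangle$) on the direct sum over $u,v\in\mathbb{C}$ of the Fock modules $\mathbb{C}[a_{-1},a_{-2},\dots,\tilde a_{-1},\tilde a_{-2},\dots]|u,v\rangle$, where $a_n|u,v\rangle=\tilde a_n|u,v\rangle=0$ for $n>0$, $a_0|u,v\rangle=u|u,v\rangle$, $\tilde a_0|u,v\rangle=v|u,v\rangle$. Put $$\phi(z)=Q+a_0\log z-\sum_{n\ne0}\tfrac1n a_nz^{-n},\qquad \tilde\phi(z)=\tilde Q+\tilde a_0\log z-\sum_{n\neq0}\tfrac1n\tilde a_nz^{-n},\qquad \psi(z)=\tfrac{1}{\sqrt{-2}}\big(:e^{\phi(z)}:-:e^{-\phi(z)}:\big),$$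 where in normally ordered products the modes $a_{-n},\tilde a_{-n}$ ($n>0$) stand to the left of $a_n,\tilde a_n$, and $Q,\tilde Q$ to the left of $a_0,\tilde a_0$. With $\sigma=\frac{1-\beta}{2\sqrt\beta}$, $t_+=\frac{1}{\sqrt\beta}$, $t_-=-\sqrt\beta$ (these are $\sigma\pm\sqrt{\sigma^2+1}$ for a suitable value of the square root), the super-Virasoro screening currents are $$\mathsf{S}^\pm(z)=t_\pm\,\psi(z)\,:e^{t_\pm\tilde\phi(z)}:.$$ *Deformed modes.* For $\hbar\in\mathbb{C}$ put $q_1=e^{\hbar}$, $q_2=e^{(\beta-1)\hbar}$, $q_3=e^{-\beta\hbar}$, $q=e^{(\beta-1)\hbar/2}$, with powers $q_1^x=e^{x\hbar}$, $q_3^x=e^{-x\beta\hbar}$. For $n>0$ and $i=1,2$, with $\epsilon_1=1$, $\epsilon_2=-1$, put $$\lambda_{i,n}=\epsilon_i\frac{(1+q_1^n)(1+q_3^n)}{2(1+q_2^{-n})}a_n+\frac{\sqrt\beta}{2}(1-q_1^n)\tilde a_n,\qquad \lambda_{i,-n}=\epsilon_i a_{-n}+\frac{1-q_3^n}{\sqrt\beta(1+q_2^{-n})}\tilde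 a_{-n},$$ and $\lambda_{1,0}=-\lambda_{2,0}=a_0$, $Q_1=Q$, $\zeta=\frac{\sqrt\beta}{2}\tilde a_0$, $Q_\zeta=\sqrt\beta\,\tilde Q$. Put $\tau_+=\frac1\beta$, $\tau_-=-1$, $s_+=q_3$, $s_-=q_1$, $\kappa^\pm_n=\dfrac{s_\pm^{n/2}(1+q_2^n)}{n\,q^n(1-s_\pm^{2n})}$, and $S^\pm(z)=S_1^\pm(z)-S_2^\pm(z)$ with $$S^\pm_1(z)=\exp\Big(\sum_{n>0}\kappa^\pm_n(\lambda_{1,-n}+s_\pm^n\lambda_{2,-n})z^n\Big)\exp\Big(\sum_{n>0}\kappa^\pm_n(s_\pm^n\lambda_{1,n}+\lambda_{2,n})z^{-n}\Big)e^{Q_1+\tau_\pm Q_\zeta}z^{\lambda_{1,0}+2\tau_\pm\zeta},$$ $$S^\pm_2(z)=\exp\Big(\sum_{n>0}\kappa^\pm_n(s_\pm^n\lambda_{1,-n}+\lambda_{2,-n})z^n\Big)\exp\Big(\sum_{n>0}\kappa^\pm_n(\lambda_{1,n}+s_\pm^n\lambda_{2,n})z^{-n}\Big)e^{-Q_1+\tau_\pm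 Q_\zeta}z^{-\lambda_{1,0}+2\tau_\pm\zeta}.$$ *Claim.* With $\beta$ fixed, $$\lim_{\hbar\to0}S^\pm(z)=\frac{\sqrt{-2}}{t_\pm}\,\mathsf{S}^\pm(z),$$ where both sides are formal series $\sum_\gamma A_\gamma z^\gamma$ with operator coefficients and the limit ($\hbar\in\mathbb{C}$, $\hbar\neq0$) is taken coefficientwise: for every exponent $\gamma$, vector $v$ and linear functional $\ell$ on the Fock module, $\ell(A_\gamma v)$ converges. (For given $\gamma$ and $v$ only finitely many modes contribute, and the denominators $1-s_\pm^{2n}$, $1+q_2^{-n}$ that occur are nonzero for all sufficiently small $\hbar\ne0$.) -/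

import Mathlib

noncomputable section

namespace ScreeningLimit

/-! ### The Fock module of two free bosons -/

/-- The oscillator part `ℂ[a_{-1}, a_{-2}, …, ã_{-1}, ã_{-2}, …]`. The variable `(false, n)` stands
for `a_{-n}` and `(true, n)` for `ã_{-n}`. -/
abbrev Osc : Type := MvPolynomial (Bool × ℕ+) ℂ

/-- The direct sum, over all `(u, v)` in `ℂ × ℂ`, of the Fock modules
`ℂ[a_{-1}, a_{-2}, …, ã_{-1}, ã_{-2}, …] |u, v⟩`, where `a_0 |u, v⟩ = u |u, v⟩` and
`ã_0 |u, v⟩ = v |u, v⟩`. -/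
abbrev Fock : Type := (ℂ × ℂ) →₀ Osc

/-- An operator on the oscillator part, acting in the same way on every summand. -/
def onOsc (f : Module.End ℂ Osc) : Module.End ℂ Fock := Finsupp.mapRange.linearMap f

/-- The operator that acts on the summand of weight `(u, v)` as the scalar `c (u, v)`. -/
def onWeight (c : ℂ × ℂ → ℂ) : Module.End ℂ Fock :=
  Finsupp.lsum ℂ fun w => c w • (Finsupp.lsingle w : Osc →ₗ[ℂ] Fock)

/-- The Heisenberg modes: `mode false n = a_n` and `mode true n = ã_n`. -/
def mode (i : Bool) (n : ℤ) : Module.End ℂ Fock :=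
  if 0 < n then
    onOsc ((n : ℂ) • (MvPolynomial.pderiv (R := ℂ) (i, n.toNat.toPNat')).toLinearMap)
  else if n < 0 then
    onOsc (LinearMap.mulLeft ℂ (MvPolynomial.X (i, (-n).toNat.toPNat') : Osc))
  else
    onWeight fun w => if i then w.2 else w.1

/-- `a_n` -/
abbrev a (n : ℤ) : Module.End ℂ Fock := mode false n

/-- `ã_n` -/
abbrev aTilde (n : ℤ) : Module.End ℂ Fock := mode true n

/-- The operator `e^{x Q + y Q̃}`, where `Q`, `Q̃` are the conjugates of the zero modes,
`[a_0, Q] = [ã_0, Q̃] = 1`; it maps `|u, v⟩` to `|u + x, v + y⟩` and commutes with all `a_n`, `ã_n`,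
`n ≠ 0`. The pair `(x, y)` stands for `x Q + y Q̃`. -/
def expShift (p : ℂ × ℂ) : Module.End ℂ Fock := Finsupp.lmapDomain Osc ℂ fun w => w + p

/-! ### Formal fields -/

/-- Formal series `∑_γ A_γ z^γ` with arbitrary complex exponents, whose coefficients `A_γ` are
operators on the Fock module. -/
abbrev FormalField : Type := ℂ → Module.End ℂ Fock

open Classical in
/-- The product `A(z) B(z) = ∑_γ (∑_δ A_δ B_{γ-δ}) z^γ`. The inner sums are required to be finite on
every vector; a coefficient for which this fails is set to `0`. -/
def fieldMul (A B : FormalField) : FormalField := fun γ =>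
  if h : ∀ v : Fock, {δ : ℂ | A δ (B (γ - δ) v) ≠ 0}.Finite then
    { toFun := fun v => ∑ᶠ δ : ℂ, A δ (B (γ - δ) v)
      map_add' := by
        intro v w
        rw [← finsum_add_distrib (h v) (h w)]
        simp only [map_add]
      map_smul' := by
        intro c v
        rw [RingHom.id_apply, smul_finsum' c (h v)]
        simp only [map_smul] }
  else 0

/-- The exponential `∑_k C^k / k!` of a power series with operator coefficients and zero constant
term. The coefficient of `X^m` in `C^k` vanishes for `k > m`. -/
def expSeries (C : PowerSeries (Module.End ℂ Fock)) : PowerSeries (Module.End ℂ Fock) :=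
  PowerSeries.mk fun m =>
    ∑ k ∈ Finset.range (m + 1), ((k.factorial : ℂ)⁻¹) • PowerSeries.coeff m (C ^ k)

/-- `∑_{n > 0} c_n X^n` -/
def posSeries (c : ℕ → Module.End ℂ Fock) : PowerSeries (Module.End ℂ Fock) :=
  PowerSeries.mk fun n => if n = 0 then 0 else c n

/-- `exp (∑_{n > 0} c_n z^n)` -/
def expCreate (c : ℕ → Module.End ℂ Fock) : FormalField :=
  Function.extend (fun m : ℕ => (m : ℂ)) (fun m => PowerSeries.coeff m (expSeries (posSeries c))) 0

/-- `exp (∑_{n > 0} c_n z^{-n})` -/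
def expAnnihilate (c : ℕ → Module.End ℂ Fock) : FormalField :=
  Function.extend (fun m : ℕ => -(m : ℂ)) (fun m => PowerSeries.coeff m (expSeries (posSeries c))) 0

/-- A field that does not depend on `z`. -/
def constField (A : Module.End ℂ Fock) : FormalField := Pi.single 0 A

open Classical in
/-- `z^{x a_0 + y ã_0}`, which acts on the summand of weight `(u, v)` as `z^{x u + y v}`. The pair
`(x, y)` stands for `x a_0 + y ã_0`. -/
def zPow (p : ℂ × ℂ) : FormalField := fun γ =>
  onWeight fun w => if p.1 * w.1 + p.2 * w.2 = γ then 1 else 0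

/-- `exp (∑_{n>0} c_n z^n) exp (∑_{n>0} d_n z^{-n}) e^{x Q + y Q̃} z^{x' a_0 + y' ã_0}`, for
`Qpart = (x, y)` and `zeroPart = (x', y')`. -/
def vertexOp (c d : ℕ → Module.End ℂ Fock) (Qpart zeroPart : ℂ × ℂ) : FormalField :=
  fieldMul (fieldMul (expCreate c) (expAnnihilate d))
    (fieldMul (constField (expShift Qpart)) (zPow zeroPart))

/-! ### The super Virasoro screening currents -/

/-- `:e^{t φ(z)}:`, where `φ(z) = Q + a_0 log z - ∑_{n ≠ 0} (1/n) a_n z^{-n}`. -/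
def normalExp (t : ℂ) : FormalField :=
  vertexOp (fun n => (t / n) • a (-n)) (fun n => (-(t / n)) • a n) (t, 0) (t, 0)

/-- `:e^{t φ̃(z)}:`, where `φ̃(z) = Q̃ + ã_0 log z - ∑_{n ≠ 0} (1/n) ã_n z^{-n}`. -/
def normalExpTilde (t : ℂ) : FormalField :=
  vertexOp (fun n => (t / n) • aTilde (-n)) (fun n => (-(t / n)) • aTilde n) (0, t) (0, t)

/-- The fermion `ψ(z) = (1/√-2) (:e^{φ(z)}: - :e^{-φ(z)}:)`, where `r` is the chosen value of
`√-2`. -/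
def fermion (r : ℂ) : FormalField := r⁻¹ • (normalExp 1 - normalExp (-1))

/-- The super Virasoro screening current `t ψ(z) :e^{t φ̃(z)}:`. -/
def superScreening (r t : ℂ) : FormalField := t • fieldMul (fermion r) (normalExpTilde t)

/-- The two signs. -/
inductive Sgn : Type
  | plus : Sgn
  | minus : Sgn

/-- `t_+ = 1/√β` and `t_- = -√β`, where `b` is the chosen value of `√β`. -/
def tPM (b : ℂ) : Sgn → ℂ
  | .plus => 1 / b
  | .minus => -b

/-! ### The deformed modes and their realization -/

/-- `q_1 ^ x`, where `q_1 = e^ħ`. -/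
def q1Pow (hbar x : ℂ) : ℂ := Complex.exp (x * hbar)

/-- `q_2 ^ x`, where `q_2 = e^{(β-1)ħ}`. -/
def q2Pow (β hbar x : ℂ) : ℂ := Complex.exp (x * ((β - 1) * hbar))

/-- `q_3 ^ x`, where `q_3 = e^{-βħ}`. -/
def q3Pow (β hbar x : ℂ) : ℂ := Complex.exp (x * (-β * hbar))

/-- `q ^ x`, where `q = e^{(β-1)ħ/2}`, so that `q_2 = q ^ 2`. -/
def qPow (β hbar x : ℂ) : ℂ := Complex.exp (x * ((β - 1) * hbar / 2))

/-- The realization of `λ_{1,n}`, with `b = √β`. -/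
def lam1 (β b hbar : ℂ) (n : ℤ) : Module.End ℂ Fock :=
  if 0 < n then
    ((1 + q1Pow hbar n) * (1 + q3Pow β hbar n) / (2 * (1 + q2Pow β hbar (-n)))) • a n
      + (b / 2 * (1 - q1Pow hbar n)) • aTilde n
  else if n < 0 then
    a n + ((1 - q3Pow β hbar (-n)) / (b * (1 + q2Pow β hbar n))) • aTilde n
  else a 0

/-- The realization of `λ_{2,n}`, with `b = √β`. -/
def lam2 (β b hbar : ℂ) (n : ℤ) : Module.End ℂ Fock :=
  if 0 < n then
    (-((1 + q1Pow hbar n) * (1 + q3Pow β hbar n) / (2 * (1 + q2Pow β hbar (-n))))) • a n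
      + (b / 2 * (1 - q1Pow hbar n)) • aTilde n
  else if n < 0 then
    -a n + ((1 - q3Pow β hbar (-n)) / (b * (1 + q2Pow β hbar n))) • aTilde n
  else -a 0

/-- `λ_{1,0} = a_0`, as a combination of `a_0` and `ã_0`. -/
def lam1Zero : ℂ × ℂ := (1, 0)

/-- The zero mode `ζ = (√β/2) ã_0` that appears in `z^{±λ_{1,0} + 2 τ ζ}`, as a combination of
`a_0` and `ã_0`. -/
def zetaZero (b : ℂ) : ℂ × ℂ := (0, b / 2)

/-- The conjugate `Q_1 = Q` of `λ_{1,0}`, as a combination of `Q` and `Q̃`. -/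
def Q1 : ℂ × ℂ := (1, 0)

/-- The conjugate `Q_ζ = √β Q̃` of `ζ`, with `[ζ, Q_ζ] = β/2`, as a combination of `Q` and `Q̃`. -/
def Qzeta (b : ℂ) : ℂ × ℂ := (0, b)

/-! ### The deformed screening currents -/

/-- `τ_+ = 1/β`, `τ_- = -1` -/
def tau (β : ℂ) : Sgn → ℂ
  | .plus => 1 / β
  | .minus => -1

/-- `s_± ^ x`, where `s_+ = q_3` and `s_- = q_1`. -/
def sPow (β hbar : ℂ) : Sgn → ℂ → ℂ
  | .plus, x => q3Pow β hbar x
  | .minus, x => q1Pow hbar x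

/-- `s_±^{n/2} (1 + q_2^n) / (n q^n (1 - s_±^{2n}))` -/
def screeningCoeff (β hbar : ℂ) (e : Sgn) (n : ℕ) : ℂ :=
  sPow β hbar e (n / 2) * (1 + q2Pow β hbar n)
    / (n * qPow β hbar n * (1 - sPow β hbar e (2 * n)))

/-- `S^±_1(z)` -/
def screening1 (β b hbar : ℂ) (e : Sgn) : FormalField :=
  vertexOp
    (fun n => screeningCoeff β hbar e n •
      (lam1 β b hbar (-n) + sPow β hbar e n • lam2 β b hbar (-n)))
    (fun n => screeningCoeff β hbar e n •
      (sPow β hbar e n • lam1 β b hbar n + lam2 β b hbar n))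
    (Q1 + tau β e • Qzeta b)
    (lam1Zero + (2 * tau β e) • zetaZero b)

/-- `S^±_2(z)` -/
def screening2 (β b hbar : ℂ) (e : Sgn) : FormalField :=
  vertexOp
    (fun n => screeningCoeff β hbar e n •
      (sPow β hbar e n • lam1 β b hbar (-n) + lam2 β b hbar (-n)))
    (fun n => screeningCoeff β hbar e n •
      (lam1 β b hbar n + sPow β hbar e n • lam2 β b hbar n))
    (-Q1 + tau β e • Qzeta b)
    (-lam1Zero + (2 * tau β e) • zetaZero b)

/-- The screening current `S^±(z) = S^±_1(z) - S^±_2(z)` under the realization. -/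
def screening (β b hbar : ℂ) (e : Sgn) : FormalField :=
  screening1 β b hbar e - screening2 β b hbar e

/-- Coefficientwise convergence `A^{(ħ)}(z) → B(z)` as `ħ → 0`, `ħ ≠ 0`: for every exponent `γ`, every
vector `v` and every linear functional `ℓ` on the Fock module, `ℓ(A^{(ħ)}_γ v) → ℓ(B_γ v)`. -/
def HasLimitAtZero (A : ℂ → FormalField) (B : FormalField) : Prop :=
  ∀ (γ : ℂ) (v : Fock) (l : Fock →ₗ[ℂ] ℂ),
    Filter.Tendsto (fun hbar => l (A hbar γ v)) (nhdsWithin 0 {0}ᶜ) (nhds (l (B γ v)))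

end ScreeningLimit

end

noncomputable section

namespace ScreeningLimit

open Finset PowerSeries

/-! ### Exponentials of operator-valued power series -/

/-! Both sides are differences of two vertex operators with the same zero-mode parts `(±1, t)`,
where `t = tPM b e`. On the undeformed side, the `a` and `ã` oscillators commute and `z^{±a_0}` is
blind to the shift `e^{t Q̃}`, so each product `:e^{±φ}: :e^{t φ̃}:` is already normally ordered and
merges into one vertex operator (`vertexOp_mul_vertexOp`). On the deformed side, collecting the
modes gives the same shape, with zero modes independent of `ħ` because `τ √β = t` (`screening1_eq`,
`screening2_eq`).

Only scalar coefficients remain to be compared. With `s = e^{cħ}`, the prefactor `κ_n` has a simple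
pole, `κ_n ~ -1/(n² c ħ)`, and every mode coefficient contains a factor `1 - s^n`, `1 - q_3^n` or `1
- q_1^n` with a simple zero; the products tend to `±1/n` and `±t/n`
(`tendsto_screeningCoeff_mul_of_div`).

Scalar convergence passes to the fields because a vector of degree at most `N` is killed by every
annihilation coefficient of order above `N`, for all `ħ` at once. Hence `A_γ v` is a fixed finite
sum of polynomials in finitely many modes, and it converges inside a finite-dimensional space
(`oscField_apply`, `opTendsto_vertexOp`). -/

theorem sum_range_sum_range_eq_sum_antidiagonal {M : Type*} [AddCommMonoid M] (f : ℕ → ℕ → M)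
    (K : ℕ) (h : ∀ i j, K ≤ i + j → f i j = 0) :
    ∑ i ∈ range K, ∑ j ∈ range K, f i j
      = ∑ n ∈ range K, ∑ p ∈ antidiagonal n, f p.1 p.2 := by
  rw [← Finset.sum_product']
  have h1 : ∑ p ∈ range K ×ˢ range K with p.1 + p.2 < K, f p.1 p.2
      = ∑ p ∈ range K ×ˢ range K, f p.1 p.2 := by
    apply Finset.sum_subset (Finset.filter_subset _ _)
    intro p hp hp'
    apply h
    by_contra hlt
    exact hp' (Finset.mem_filter.2 ⟨hp, by omega⟩)
  rw [← h1, ← Finset.sum_fiberwise_of_maps_to (t := range K) (g := fun p : ℕ × ℕ => p.1 + p.2)]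
  · apply Finset.sum_congr rfl
    intro n hn
    apply Finset.sum_congr _ fun _ _ => rfl
    ext p
    simp only [Finset.mem_filter, Finset.mem_product, Finset.mem_range, HasAntidiagonal.mem_antidiagonal] at *
    omega
  · intro p hp
    simpa using (Finset.mem_filter.1 hp).2

theorem coeff_pow_mul_pow_eq_zero {R : Type*} [Semiring R] {C D : PowerSeries R}
    (hC : constantCoeff C = 0) (hD : constantCoeff D = 0) {m i j : ℕ} (h : m < i + j) :
    coeff m (C ^ i * D ^ j) = 0 := by
  apply coeff_of_lt_order
  refine lt_of_lt_of_le ?_ (le_order_mul _ _)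
  refine lt_of_lt_of_le ?_ (add_le_add (le_order_pow_of_constantCoeff_eq_zero i hC)
    (le_order_pow_of_constantCoeff_eq_zero j hD))
  exact_mod_cast h

theorem coeff_pow_eq_zero {R : Type*} [Semiring R] {C : PowerSeries R}
    (hC : constantCoeff C = 0) {m i : ℕ} (h : m < i) : coeff m (C ^ i) = 0 := by
  simpa using coeff_pow_mul_pow_eq_zero hC hC (j := 0) (by simpa using h)

/-- Frees the truncation point from `m`, so that several coefficients can be expanded over one
common range. -/
theorem coeff_expSeries {C : PowerSeries (Module.End ℂ Fock)} (hC : constantCoeff C = 0)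
    {m K : ℕ} (h : m < K) :
    coeff m (expSeries C) = ∑ k ∈ range K, ((k.factorial : ℂ)⁻¹) • coeff m (C ^ k) := by
  rw [expSeries, coeff_mk]
  apply Finset.sum_subset
  · intro k hk
    simp only [Finset.mem_range] at *
    omega
  · intro k _ hk
    rw [coeff_pow_eq_zero hC, smul_zero]
    simpa using hk

/-- The binomial theorem for commuting `C`, `D`. The product of truncated exponentials runs over a
square of pairs `(i, j)`; those with `i + j > m` drop out because `C^i D^j` has order at least `i +
j`. -/
theorem coeff_expSeries_add {C D : PowerSeries (Module.End ℂ Fock)} (hC : constantCoeff C = 0)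
    (hD : constantCoeff D = 0) (hCD : Commute C D) (m : ℕ) :
    coeff m (expSeries (C + D))
      = ∑ p ∈ antidiagonal m, coeff p.1 (expSeries C) * coeff p.2 (expSeries D) := by
  have h1 : ∀ p ∈ antidiagonal m, coeff p.1 (expSeries C) * coeff p.2 (expSeries D)
      = ∑ i ∈ range (m + 1), ∑ j ∈ range (m + 1),
          ((i.factorial : ℂ)⁻¹ * (j.factorial : ℂ)⁻¹) • (coeff p.1 (C ^ i) * coeff p.2 (D ^ j)) := by
    intro p hp
    have := HasAntidiagonal.mem_antidiagonal.1 hp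
    rw [coeff_expSeries hC (K := m + 1) (by omega), coeff_expSeries hD (K := m + 1) (by omega),
      Finset.sum_mul_sum]
    simp only [smul_mul_smul_comm]
  rw [Finset.sum_congr rfl h1, Finset.sum_comm]
  have h2 : ∀ i, ∑ p ∈ antidiagonal m, ∑ j ∈ range (m + 1),
      ((i.factorial : ℂ)⁻¹ * (j.factorial : ℂ)⁻¹) • (coeff p.1 (C ^ i) * coeff p.2 (D ^ j))
      = ∑ j ∈ range (m + 1),
        ((i.factorial : ℂ)⁻¹ * (j.factorial : ℂ)⁻¹) • coeff m (C ^ i * D ^ j) := by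
    intro i
    rw [Finset.sum_comm]
    simp only [coeff_mul, Finset.smul_sum]
  simp only [h2]
  rw [sum_range_sum_range_eq_sum_antidiagonal (fun i j =>
    ((i.factorial : ℂ)⁻¹ * (j.factorial : ℂ)⁻¹) • coeff m (C ^ i * D ^ j))]
  · rw [coeff_expSeries (by simp [hC, hD]) (Nat.lt_succ_self m)]
    apply Finset.sum_congr rfl
    intro n _
    rw [hCD.add_pow', map_sum, Finset.smul_sum]
    apply Finset.sum_congr rfl
    intro p hp
    rw [map_nsmul, ← Nat.cast_smul_eq_nsmul ℂ, smul_smul]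
    congr 1
    have hp' := HasAntidiagonal.mem_antidiagonal.1 hp
    have := Nat.add_choose_mul_factorial_mul_factorial p.1 p.2
    rw [← Nat.choose_symm_add, hp'] at this
    have hn : (n.factorial : ℂ) ≠ 0 := by exact_mod_cast n.factorial_ne_zero
    have h1 : (p.1.factorial : ℂ) ≠ 0 := by exact_mod_cast p.1.factorial_ne_zero
    have h2 : (p.2.factorial : ℂ) ≠ 0 := by exact_mod_cast p.2.factorial_ne_zero
    field_simp
    norm_cast
  · intro i j hij
    rw [coeff_pow_mul_pow_eq_zero hC hD (by omega), smul_zero]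

theorem coeff_pow_mem {R : Type*} [Semiring R] [Algebra ℂ R] (S : Subalgebra ℂ R)
    {C : PowerSeries R} (hC : ∀ n, coeff n C ∈ S) (k m : ℕ) : coeff m (C ^ k) ∈ S := by
  induction k generalizing m with
  | zero =>
    rw [pow_zero, coeff_one]
    split_ifs
    · exact S.one_mem
    · exact S.zero_mem
  | succ k ih =>
    rw [pow_succ, coeff_mul]
    exact S.sum_mem fun p _ => S.mul_mem (ih _) (hC _)

/-- The coefficient of `z^m` in `exp (∑_{n > 0} c_n z^n)`. -/
def expCoeff (c : ℕ → Module.End ℂ Fock) (m : ℕ) : Module.End ℂ Fock :=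
  coeff m (expSeries (posSeries c))

theorem coeff_posSeries (c : ℕ → Module.End ℂ Fock) (n : ℕ) :
    coeff n (posSeries c) = if n = 0 then 0 else c n := by
  rw [posSeries, coeff_mk]

theorem constantCoeff_posSeries (c : ℕ → Module.End ℂ Fock) :
    constantCoeff (posSeries c) = 0 := by
  rw [← coeff_zero_eq_constantCoeff_apply, coeff_posSeries, if_pos rfl]

theorem posSeries_congr {c c' : ℕ → Module.End ℂ Fock} (h : ∀ n, 0 < n → c n = c' n) :
    posSeries c = posSeries c' := by
  ext1 n
  rw [coeff_posSeries, coeff_posSeries]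
  split_ifs with hn
  · rfl
  · exact h n (Nat.pos_of_ne_zero hn)

theorem expCoeff_mem (S : Subalgebra ℂ (Module.End ℂ Fock)) {c : ℕ → Module.End ℂ Fock}
    (hc : ∀ n, 0 < n → c n ∈ S) (m : ℕ) : expCoeff c m ∈ S := by
  rw [expCoeff, expSeries, coeff_mk]
  have h : ∀ n, coeff n (posSeries c) ∈ S := by
    intro n
    rw [coeff_posSeries]
    split_ifs with hn
    · exact S.zero_mem
    · exact hc n (Nat.pos_of_ne_zero hn)
  exact S.sum_mem fun k _ => S.smul_mem (coeff_pow_mem S h _ _) _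

/-- Each coefficient is a polynomial in the `c n`, so it stays in the centralizer of `A`, which is a
subalgebra. -/
theorem commute_expCoeff_right {A : Module.End ℂ Fock} {c : ℕ → Module.End ℂ Fock}
    (h : ∀ n, 0 < n → Commute A (c n)) (m : ℕ) : Commute A (expCoeff c m) := by
  have := expCoeff_mem (Subalgebra.centralizer ℂ {A}) (c := c)
    (fun n hn => by
      rw [Subalgebra.mem_centralizer_iff]
      rintro _ rfl
      exact h n hn) m
  rw [Subalgebra.mem_centralizer_iff] at this
  exact this A rfl

theorem commute_expCoeff {c d : ℕ → Module.End ℂ Fock}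
    (h : ∀ i j, 0 < i → 0 < j → Commute (c i) (d j)) (m n : ℕ) :
    Commute (expCoeff c m) (expCoeff d n) :=
  commute_expCoeff_right (fun j hj =>
    (commute_expCoeff_right (fun i hi => (h i j hi hj).symm) m).symm) n

theorem expCoeff_add {c d : ℕ → Module.End ℂ Fock}
    (h : ∀ i j, 0 < i → 0 < j → Commute (c i) (d j)) (m : ℕ) :
    expCoeff (c + d) m = ∑ p ∈ antidiagonal m, expCoeff c p.1 * expCoeff d p.2 := by
  have hadd : posSeries (c + d) = posSeries c + posSeries d := by
    ext1 n
    rw [map_add]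
    simp only [coeff_posSeries]
    split_ifs
    · simp
    · rfl
  rw [expCoeff, hadd, coeff_expSeries_add (constantCoeff_posSeries c) (constantCoeff_posSeries d)]
  · rfl
  · have hcomm : ∀ i j, Commute (coeff i (posSeries c)) (coeff j (posSeries d)) := by
      intro i j
      simp only [coeff_posSeries]
      rcases Nat.eq_zero_or_pos i with rfl | hi
      · simp
      rcases Nat.eq_zero_or_pos j with rfl | hj
      · simp
      simpa [hi.ne', hj.ne'] using h i j hi hj
    show _ = _
    ext1 n
    rw [coeff_mul, coeff_mul, ← Finset.Nat.sum_antidiagonal_swap]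
    exact Finset.sum_congr rfl fun p _ => (hcomm _ _).eq

end ScreeningLimit

end

noncomputable section

namespace ScreeningLimit

open Finset PowerSeries

/-! ### Commutation of the modes -/

theorem onOsc_single (f : Module.End ℂ Osc) (p : ℂ × ℂ) (x : Osc) :
    onOsc f (Finsupp.single p x) = Finsupp.single p (f x) := by
  simp [onOsc]

theorem onWeight_single (c : ℂ × ℂ → ℂ) (p : ℂ × ℂ) (x : Osc) :
    onWeight c (Finsupp.single p x) = c p • Finsupp.single p x := by
  simp [onWeight]

theorem expShift_single (q p : ℂ × ℂ) (x : Osc) :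
    expShift q (Finsupp.single p x) = Finsupp.single (p + q) x := by
  simp [expShift]

theorem onOsc_commute {f g : Module.End ℂ Osc} (h : Commute f g) :
    Commute (onOsc f) (onOsc g) := by
  refine Finsupp.lhom_ext fun p x => ?_
  simp only [Module.End.mul_apply, onOsc_single]
  exact congrArg _ (LinearMap.congr_fun h.eq x)

theorem onOsc_commute_expShift (f : Module.End ℂ Osc) (q : ℂ × ℂ) :
    Commute (onOsc f) (expShift q) := by
  refine Finsupp.lhom_ext fun p x => ?_
  simp only [Module.End.mul_apply, onOsc_single, expShift_single]

theorem onOsc_commute_onWeight (f : Module.End ℂ Osc) (c : ℂ × ℂ → ℂ) :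
    Commute (onOsc f) (onWeight c) := by
  refine Finsupp.lhom_ext fun p x => ?_
  simp only [Module.End.mul_apply, onOsc_single, onWeight_single, map_smul]

theorem mode_natCast (i : Bool) {n : ℕ} (hn : 0 < n) :
    mode i n = onOsc ((n : ℂ) • (MvPolynomial.pderiv (R := ℂ) (i, n.toPNat')).toLinearMap) := by
  rw [mode, if_pos (by exact_mod_cast hn)]
  simp

theorem mode_neg_natCast (i : Bool) {n : ℕ} (hn : 0 < n) :
    mode i (-(n : ℤ)) = onOsc (LinearMap.mulLeft ℂ (MvPolynomial.X (i, n.toPNat') : Osc)) := by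
  rw [mode, if_neg (by omega), if_pos (by omega)]
  simp

theorem mode_eq_onOsc (i : Bool) {n : ℤ} (hn : n ≠ 0) : ∃ f, mode i n = onOsc f := by
  rcases lt_or_gt_of_ne hn with h | h
  · exact ⟨_, by rw [mode, if_neg (by omega), if_pos h]⟩
  · exact ⟨_, by rw [mode, if_pos h]⟩

theorem mode_commute_expShift (i : Bool) {n : ℤ} (hn : n ≠ 0) (q : ℂ × ℂ) :
    Commute (mode i n) (expShift q) := by
  obtain ⟨f, hf⟩ := mode_eq_onOsc i hn
  exact hf ▸ onOsc_commute_expShift f q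

theorem mode_commute_onWeight (i : Bool) {n : ℤ} (hn : n ≠ 0) (c : ℂ × ℂ → ℂ) :
    Commute (mode i n) (onWeight c) := by
  obtain ⟨f, hf⟩ := mode_eq_onOsc i hn
  exact hf ▸ onOsc_commute_onWeight f c

theorem mode_neg_commute (i j : Bool) {m n : ℕ} (hm : 0 < m) (hn : 0 < n) :
    Commute (mode i (-(m : ℤ))) (mode j (-(n : ℤ))) := by
  rw [mode_neg_natCast i hm, mode_neg_natCast j hn]
  refine onOsc_commute (LinearMap.ext fun x => ?_)
  simp only [Module.End.mul_apply, LinearMap.mulLeft_apply]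
  ring

/-- The commutator of two derivations is a derivation, and this one vanishes on the variables. -/
theorem pderiv_pderiv_comm {σ : Type*} (i j : σ) (x : MvPolynomial σ ℂ) :
    MvPolynomial.pderiv i (MvPolynomial.pderiv j x)
      = MvPolynomial.pderiv j (MvPolynomial.pderiv i x) := by
  have h : ⁅MvPolynomial.pderiv (R := ℂ) i, MvPolynomial.pderiv (R := ℂ) j⁆ = 0 := by
    classical
    apply MvPolynomial.derivation_ext
    intro k
    rw [Derivation.commutator_apply]
    simp only [MvPolynomial.pderiv_X, Pi.single_apply]
    split_ifs <;> simp
  have := DFunLike.congr_fun h x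
  rwa [Derivation.commutator_apply, Derivation.zero_apply, sub_eq_zero] at this

theorem mode_pos_commute (i j : Bool) {m n : ℕ} (hm : 0 < m) (hn : 0 < n) :
    Commute (mode i (m : ℤ)) (mode j (n : ℤ)) := by
  rw [mode_natCast i hm, mode_natCast j hn]
  refine onOsc_commute (Commute.smul_left (Commute.smul_right ?_ _) _)
  exact LinearMap.ext fun x => pderiv_pderiv_comm _ _ x

theorem mode_pos_commute_mode_neg {i j : Bool} (hij : i ≠ j) {m n : ℕ} (hm : 0 < m)
    (hn : 0 < n) : Commute (mode i (m : ℤ)) (mode j (-(n : ℤ))) := by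
  rw [mode_natCast i hm, mode_neg_natCast j hn]
  refine onOsc_commute (Commute.smul_left ?_ _)
  refine LinearMap.ext fun x => ?_
  have : MvPolynomial.pderiv (R := ℂ) (i, m.toPNat') (MvPolynomial.X (j, n.toPNat')) = 0 :=
    MvPolynomial.pderiv_X_of_ne fun h => hij (congrArg Prod.fst h).symm
  simp [Derivation.leibniz, this]

/-! ### The filtration by the oscillator degree -/

/-- The degree of a monomial in which `a_{-n}` and `ã_{-n}` have degree `n`. -/
def oscDegree : (Bool × ℕ+ →₀ ℕ) →+ ℕ := Finsupp.weight fun i => (i.2 : ℕ)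

/-- The span of the basis vectors of degree at most `N`. -/
def degreeLE (N : ℤ) : Submodule ℂ Fock :=
  Submodule.span ℂ {v | ∃ p s, (oscDegree s : ℤ) ≤ N ∧
    v = Finsupp.single p (MvPolynomial.monomial s (1 : ℂ))}

/-- `T` lowers the degree by at least `k`. -/
def Lowers (k : ℕ) (T : Module.End ℂ Fock) : Prop :=
  ∀ N, ∀ v ∈ degreeLE N, T v ∈ degreeLE (N - k)

theorem degreeLE_mono {M N : ℤ} (h : M ≤ N) : degreeLE M ≤ degreeLE N := by
  apply Submodule.span_mono
  rintro _ ⟨p, s, hs, rfl⟩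
  exact ⟨p, s, hs.trans h, rfl⟩

/-- Degrees are natural numbers; indexing the filtration by `ℤ` lets an operator that lowers too far
be seen to vanish. -/
theorem eq_zero_of_mem_degreeLE {N : ℤ} (hN : N < 0) {v : Fock} (hv : v ∈ degreeLE N) : v = 0 := by
  have : degreeLE N = ⊥ := by
    rw [degreeLE, Submodule.span_eq_bot]
    rintro _ ⟨p, s, hs, rfl⟩
    omega
  rwa [this, Submodule.mem_bot] at hv

theorem exists_mem_degreeLE (v : Fock) : ∃ N : ℕ, v ∈ degreeLE N := by
  have hadd : ∀ v w : Fock, (∃ N : ℕ, v ∈ degreeLE N) → (∃ N : ℕ, w ∈ degreeLE N) →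
      ∃ N : ℕ, v + w ∈ degreeLE N := by
    rintro v w ⟨M, hM⟩ ⟨N, hN⟩
    exact ⟨max M N, Submodule.add_mem _ (degreeLE_mono (by simp) hM)
      (degreeLE_mono (by simp) hN)⟩
  induction v using Finsupp.induction_linear with
  | zero => exact ⟨0, Submodule.zero_mem _⟩
  | add f g hf hg => exact hadd f g hf hg
  | single p x =>
    induction x using MvPolynomial.induction_on' with
    | monomial s c =>
      refine ⟨oscDegree s, ?_⟩
      have : Finsupp.single p (MvPolynomial.monomial s c)
          = c • Finsupp.single p (MvPolynomial.monomial s (1 : ℂ)) := by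
        rw [Finsupp.smul_single, MvPolynomial.smul_monomial, smul_eq_mul, mul_one]
      rw [this]
      exact Submodule.smul_mem _ _ (Submodule.subset_span ⟨p, s, le_rfl, rfl⟩)
    | add x y hx hy =>
      rw [Finsupp.single_add]
      exact hadd _ _ hx hy

theorem lowers_mode (i : Bool) {n : ℕ} (hn : 0 < n) : Lowers n (mode i (n : ℤ)) := by
  intro N
  suffices degreeLE N ≤ (degreeLE (N - n)).comap (mode i (n : ℤ)) from fun v hv => this hv
  rw [degreeLE, Submodule.span_le]
  rintro _ ⟨p, s, hs, rfl⟩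
  rw [SetLike.mem_coe, Submodule.mem_comap, mode_natCast i hn, onOsc_single, LinearMap.smul_apply,
    ← Finsupp.smul_single]
  refine Submodule.smul_mem _ _ ?_
  change Finsupp.single p (MvPolynomial.pderiv _ _) ∈ _
  rw [MvPolynomial.pderiv_monomial, one_mul]
  set k : Bool × ℕ+ := (i, n.toPNat')
  -- If the variable is absent, the derivative is zero; this must be split off because `s - single k
  -- 1` is then a truncated subtraction.
  by_cases hk : s k = 0
  · simp [hk]
  have hs' : s - Finsupp.single k 1 + Finsupp.single k 1 = s :=
    tsub_add_cancel_of_le (Finsupp.single_le_iff.2 (Nat.one_le_iff_ne_zero.2 hk))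
  have hdeg : oscDegree (s - Finsupp.single k 1) + n = oscDegree s := by
    conv_rhs => rw [← hs', map_add]
    congr 1
    rw [oscDegree, Finsupp.weight_single, one_smul]
    exact (PNat.toPNat'_coe hn).symm
  rw [← mul_one ((s k : ℕ) : ℂ), ← smul_eq_mul, ← MvPolynomial.smul_monomial,
    ← Finsupp.smul_single]
  exact Submodule.smul_mem _ _ (Submodule.subset_span ⟨p, _, by omega, rfl⟩)

theorem lowers_zero (k : ℕ) : Lowers k 0 := fun _ _ _ => Submodule.zero_mem _

theorem lowers_one : Lowers 0 1 := fun N v hv => by simpa using hv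

theorem Lowers.add {k : ℕ} {T U : Module.End ℂ Fock} (hT : Lowers k T) (hU : Lowers k U) :
    Lowers k (T + U) := fun N v hv => Submodule.add_mem _ (hT N v hv) (hU N v hv)

theorem Lowers.smul {k : ℕ} {T : Module.End ℂ Fock} (hT : Lowers k T) (c : ℂ) :
    Lowers k (c • T) := fun N v hv => Submodule.smul_mem _ _ (hT N v hv)

theorem Lowers.mul {k l : ℕ} {T U : Module.End ℂ Fock} (hT : Lowers k T) (hU : Lowers l U) :
    Lowers (k + l) (T * U) := fun N v hv => by
  have := hT _ _ (hU N v hv)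
  rwa [sub_sub, add_comm (l : ℤ), ← Nat.cast_add] at this

theorem lowers_sum {ι : Type*} {k : ℕ} (s : Finset ι) (T : ι → Module.End ℂ Fock)
    (h : ∀ i ∈ s, Lowers k (T i)) : Lowers k (∑ i ∈ s, T i) := fun N v hv => by
  rw [LinearMap.sum_apply]
  exact Submodule.sum_mem _ fun i hi => h i hi N v hv

/-- The coefficient is a combination of products `d n₁ ⋯ d n_k` with `n₁ + ⋯ + n_k = m`, and
lowering amounts add. -/
theorem lowers_expCoeff {d : ℕ → Module.End ℂ Fock} (hd : ∀ n, 0 < n → Lowers n (d n)) (m : ℕ) :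
    Lowers m (expCoeff d m) := by
  have hpow : ∀ k m, Lowers m (coeff m (posSeries d ^ k)) := by
    intro k
    induction k with
    | zero =>
      intro m
      rw [pow_zero, coeff_one]
      split_ifs with hm
      · exact hm ▸ lowers_one
      · exact lowers_zero m
    | succ k ih =>
      intro m
      rw [pow_succ, coeff_mul]
      refine lowers_sum _ _ fun p hp => ?_
      rw [← HasAntidiagonal.mem_antidiagonal.1 hp]
      refine (ih _).mul ?_
      rw [coeff_posSeries]
      split_ifs with h0
      · exact lowers_zero _
      · exact hd _ (Nat.pos_of_ne_zero h0)
  rw [expCoeff, expSeries, coeff_mk]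
  exact lowers_sum _ _ fun k _ => (hpow k m).smul _

theorem expCoeff_apply_eq_zero {d : ℕ → Module.End ℂ Fock} (hd : ∀ n, 0 < n → Lowers n (d n))
    {N : ℕ} {v : Fock} (hv : v ∈ degreeLE N) {m : ℕ} (hm : N < m) : expCoeff d m v = 0 :=
  eq_zero_of_mem_degreeLE (by omega) (lowers_expCoeff hd m N v hv)

end ScreeningLimit

end

noncomputable section

namespace ScreeningLimit

open Finset

/-! ### Products of exponentials as formal fields -/

theorem fieldMul_apply {A B : FormalField} {γ : ℂ}
    (h : ∀ v, {δ : ℂ | A δ (B (γ - δ) v) ≠ 0}.Finite) (v : Fock) :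
    fieldMul A B γ v = ∑ᶠ δ : ℂ, A δ (B (γ - δ) v) := by
  rw [fieldMul, dif_pos h]
  rfl

/-- Reduces the finiteness condition in `fieldMul` to vectors of a single weight, where the zero
modes act as scalars. -/
theorem finite_ne_zero_of_single {T : ℂ → Module.End ℂ Fock}
    (h : ∀ p x, {δ : ℂ | T δ (Finsupp.single p x) ≠ 0}.Finite) (v : Fock) :
    {δ : ℂ | T δ v ≠ 0}.Finite := by
  induction v using Finsupp.induction_linear with
  | zero => simp
  | single p x => exact h p x
  | add v w hv hw =>
    refine (hv.union hw).subset fun δ hδ => ?_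
    by_contra hcon
    simp only [Set.mem_union, Set.mem_ofPred_eq, not_or, not_not] at hcon
    exact hδ (by rw [map_add, hcon.1, hcon.2, add_zero])

/-- The sequence `f`, regarded as a function on `ℂ` that vanishes outside `ℕ`. -/
def natExtend (f : ℕ → Module.End ℂ Fock) : FormalField :=
  Function.extend (fun m : ℕ => (m : ℂ)) f 0

theorem natExtend_natCast (f : ℕ → Module.End ℂ Fock) (m : ℕ) : natExtend f m = f m :=
  Nat.cast_injective.extend_apply f 0 m

theorem natExtend_of_ne (f : ℕ → Module.End ℂ Fock) {γ : ℂ} (h : ∀ m : ℕ, (m : ℂ) ≠ γ) :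
    natExtend f γ = 0 :=
  Function.extend_apply' _ _ _ fun ⟨m, hm⟩ => h m hm

theorem expAnnihilate_apply (d : ℕ → Module.End ℂ Fock) (m : ℕ) :
    expAnnihilate d (-(m : ℂ)) = expCoeff d m :=
  Function.Injective.extend_apply (fun m n h => by simpa using h) _ _ m

theorem expAnnihilate_of_ne (d : ℕ → Module.End ℂ Fock) {γ : ℂ} (h : ∀ m : ℕ, -(m : ℂ) ≠ γ) :
    expAnnihilate d γ = 0 :=
  Function.extend_apply' _ _ _ fun ⟨m, hm⟩ => h m hm

theorem natExtend_mul_finite (f g : ℕ → Module.End ℂ Fock) (η : ℂ) :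
    {δ : ℂ | natExtend f δ * natExtend g (η - δ) ≠ 0}.Finite := by
  by_cases hη : ∃ k : ℕ, (k : ℂ) = η
  · obtain ⟨k, rfl⟩ := hη
    refine ((range (k + 1)).image fun m : ℕ => (m : ℂ)).finite_toSet.subset fun δ hδ => ?_
    by_contra hcon
    apply hδ
    by_cases h1 : ∃ i : ℕ, (i : ℂ) = δ
    · obtain ⟨i, rfl⟩ := h1
      rw [natExtend_of_ne g, mul_zero]
      intro j hj
      have : j + i = k := by
        have : ((j + i : ℕ) : ℂ) = k := by push_cast; rw [hj]; ring
        exact_mod_cast this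
      exact hcon (by simp only [coe_image, Set.mem_image, Finset.mem_coe, Finset.mem_range]
                     exact ⟨i, by omega, rfl⟩)
    · push Not at h1
      rw [natExtend_of_ne f h1, zero_mul]
  · push Not at hη
    convert Set.finite_empty
    ext δ
    simp only [Set.mem_ofPred_eq, Set.mem_empty_iff_false, iff_false, not_not]
    by_cases h1 : ∃ i : ℕ, (i : ℂ) = δ
    · obtain ⟨i, rfl⟩ := h1
      rw [natExtend_of_ne g, mul_zero]
      intro j hj
      exact hη (j + i) (by push_cast; rw [hj]; ring)
    · push Not at h1
      rw [natExtend_of_ne f h1, zero_mul]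

theorem finsum_natExtend_mul (f g : ℕ → Module.End ℂ Fock) (η : ℂ) :
    ∑ᶠ δ : ℂ, natExtend f δ * natExtend g (η - δ)
      = natExtend (fun n => ∑ p ∈ antidiagonal n, f p.1 * g p.2) η := by
  by_cases hη : ∃ k : ℕ, (k : ℂ) = η
  · obtain ⟨k, rfl⟩ := hη
    rw [natExtend_natCast, finsum_eq_sum_of_support_subset
      (s := (antidiagonal k).image fun p : ℕ × ℕ => (p.1 : ℂ)), Finset.sum_image]
    · refine Finset.sum_congr rfl fun p hp => ?_
      rw [← HasAntidiagonal.mem_antidiagonal.1 hp, natExtend_natCast, Nat.cast_add,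
        add_sub_cancel_left, natExtend_natCast]
    · intro p hp q hq hpq
      have := HasAntidiagonal.mem_antidiagonal.1 hp
      have := HasAntidiagonal.mem_antidiagonal.1 hq
      have : p.1 = q.1 := Nat.cast_injective (R := ℂ) hpq
      ext <;> omega
    · intro δ hδ
      by_contra hcon
      apply hδ
      by_cases h1 : ∃ i : ℕ, (i : ℂ) = δ
      · obtain ⟨i, rfl⟩ := h1
        dsimp only
        rw [natExtend_of_ne g, mul_zero]
        intro j hj
        have : i + j = k := by
          have : ((i + j : ℕ) : ℂ) = k := by push_cast; rw [hj]; ring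
          exact_mod_cast this
        refine hcon ?_
        simp only [coe_image, Set.mem_image, Finset.mem_coe, HasAntidiagonal.mem_antidiagonal]
        exact ⟨(i, j), this, rfl⟩
      · push Not at h1
        dsimp only
        rw [natExtend_of_ne f h1, zero_mul]
  · push Not at hη
    rw [natExtend_of_ne _ hη, finsum_eq_zero_of_forall_eq_zero]
    intro δ
    by_cases h1 : ∃ i : ℕ, (i : ℂ) = δ
    · obtain ⟨i, rfl⟩ := h1
      rw [natExtend_of_ne g, mul_zero]
      intro j hj
      exact hη (j + i) (by push_cast; rw [hj]; ring)
    · push Not at h1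
      rw [natExtend_of_ne f h1, zero_mul]

/-- `exp (∑_{n>0} c_n z^n) exp (∑_{n>0} d_n z^{-n})` -/
def oscField (c d : ℕ → Module.End ℂ Fock) : FormalField :=
  fieldMul (expCreate c) (expAnnihilate d)

theorem support_create_annihilate (c d : ℕ → Module.End ℂ Fock) {v : Fock} {K : ℕ}
    (hK : ∀ m, K ≤ m → expCoeff d m v = 0) (γ : ℂ) :
    {δ : ℂ | expCreate c δ (expAnnihilate d (γ - δ) v) ≠ 0}
      ⊆ ((range K).image fun m : ℕ => γ + m : Finset ℂ) := by
  intro δ hδ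
  by_contra hcon
  apply hδ
  by_cases h1 : ∃ m : ℕ, -(m : ℂ) = γ - δ
  · obtain ⟨m, hm⟩ := h1
    rw [← hm, expAnnihilate_apply, hK, map_zero]
    by_contra hlt
    refine hcon ?_
    simp only [coe_image, Set.mem_image, Finset.mem_coe, Finset.mem_range]
    exact ⟨m, by omega, by linear_combination -hm⟩
  · push Not at h1
    rw [expAnnihilate_of_ne d h1, LinearMap.zero_apply, map_zero]

/-- An annihilation term `z^{-m}` forces the creation exponent `γ + m`. The bound `K` depends on `v`
alone and may be any valid one, which allows the same `K` for different fields and vectors. -/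
theorem oscField_apply (c : ℕ → Module.End ℂ Fock) {d : ℕ → Module.End ℂ Fock}
    (hd : ∀ n, 0 < n → Lowers n (d n)) {v : Fock} {K : ℕ}
    (hK : ∀ m, K ≤ m → expCoeff d m v = 0) (γ : ℂ) :
    oscField c d γ v = ∑ m ∈ range K, natExtend (expCoeff c) (γ + m) (expCoeff d m v) := by
  rw [oscField, fieldMul_apply, finsum_eq_sum_of_support_subset _
    (support_create_annihilate c d hK γ), Finset.sum_image]
  · refine Finset.sum_congr rfl fun m _ => ?_
    rw [sub_add_cancel_left, expAnnihilate_apply]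
    rfl
  · intro m _ n _ h
    simpa using h
  · intro w
    obtain ⟨N, hN⟩ := exists_mem_degreeLE w
    exact (Finset.finite_toSet _).subset (support_create_annihilate c d (K := N + 1)
      (fun m hm => expCoeff_apply_eq_zero hd hN (by omega)) γ)

theorem commute_natExtend {A : Module.End ℂ Fock} {f : ℕ → Module.End ℂ Fock}
    (h : ∀ n, Commute A (f n)) (γ : ℂ) : Commute A (natExtend f γ) := by
  by_cases hγ : ∃ k : ℕ, (k : ℂ) = γ
  · obtain ⟨k, rfl⟩ := hγ
    rw [natExtend_natCast]
    exact h k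
  · push Not at hγ
    rw [natExtend_of_ne f hγ]
    exact Commute.zero_right A

theorem commute_oscField {A : Module.End ℂ Fock} {c d : ℕ → Module.End ℂ Fock}
    (hd : ∀ n, 0 < n → Lowers n (d n)) (hAc : ∀ n, 0 < n → Commute A (c n))
    (hAd : ∀ n, 0 < n → Commute A (d n)) (γ : ℂ) : Commute A (oscField c d γ) := by
  refine LinearMap.ext fun v => ?_
  have hA : ∀ m w, A (expCoeff d m w) = expCoeff d m (A w) := fun m w =>
    LinearMap.congr_fun (commute_expCoeff_right hAd m).eq w
  obtain ⟨N, hN⟩ := exists_mem_degreeLE v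
  have hK : ∀ m, N + 1 ≤ m → expCoeff d m v = 0 := fun m hm =>
    expCoeff_apply_eq_zero hd hN (by omega)
  rw [Module.End.mul_apply, Module.End.mul_apply, oscField_apply c hd hK,
    -- `A` may raise the degree, but the bound for `v` still serves for `A v`, since `A` commutes
    -- with the annihilation coefficients.
    oscField_apply c hd (K := N + 1) fun m hm => by rw [← hA, hK m hm, map_zero], map_sum]
  refine Finset.sum_congr rfl fun m _ => ?_
  rw [← hA]
  exact LinearMap.congr_fun
    (commute_natExtend (commute_expCoeff_right hAc) (γ + m)).eq (expCoeff d m v)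

/-! ### Products of two oscillator fields. -/

section Product

variable {c d c' d' : ℕ → Module.End ℂ Fock}

theorem lowers_mul_apply_eq_zero (hd : ∀ n, 0 < n → Lowers n (d n))
    (hd' : ∀ n, 0 < n → Lowers n (d' n)) {N : ℕ} {u : Fock} (hu : u ∈ degreeLE N) {m n : ℕ}
    (h : N < m + n) : expCoeff d' n (expCoeff d m u) = 0 := by
  refine eq_zero_of_mem_degreeLE ?_
    (lowers_expCoeff hd' n _ _ (lowers_expCoeff hd m N u hu))
  omega

/-- Normal ordering without contraction: the left annihilation part passes through the whole right
field. The second creation exponent `η - δ + n` is written so that the two exponents visibly sum to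
`η + m + n`, which prepares the convolution in `δ`. -/
theorem oscField_oscField_apply (hd : ∀ n, 0 < n → Lowers n (d n))
    (hd' : ∀ n, 0 < n → Lowers n (d' n))
    (hdd : ∀ i j, 0 < i → 0 < j → Commute (d i) (d' j))
    (hdc : ∀ i j, 0 < i → 0 < j → Commute (d i) (c' j))
    {N : ℕ} {u : Fock} (hu : u ∈ degreeLE N) (η δ : ℂ) :
    oscField c d δ (oscField c' d' (η - δ) u)
      = ∑ m ∈ range (N + 1), ∑ n ∈ range (N + 1),
        (natExtend (expCoeff c) (δ + m) * natExtend (expCoeff c') (η + m + n - (δ + m)))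
          (expCoeff d' n (expCoeff d m u)) := by
  have hcomm : ∀ m w, expCoeff d m (oscField c' d' (η - δ) w)
      = oscField c' d' (η - δ) (expCoeff d m w) := by
    intro m w
    refine LinearMap.congr_fun (commute_oscField hd' (fun n hn => ?_) (fun n hn => ?_) _).eq w
    · exact (commute_expCoeff_right (fun i hi => (hdc i n hi hn).symm) m).symm
    · exact (commute_expCoeff_right (fun i hi => (hdd i n hi hn).symm) m).symm
  rw [oscField_apply c hd (K := N + 1)]
  · refine Finset.sum_congr rfl fun m _ => ?_
    rw [hcomm, oscField_apply c' hd' (K := N + 1) fun n hn =>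
      lowers_mul_apply_eq_zero hd hd' hu (by omega), map_sum]
    refine Finset.sum_congr rfl fun n _ => ?_
    rw [Module.End.mul_apply]
    congr 3
    ring
  · intro m hm
    rw [hcomm, expCoeff_apply_eq_zero hd hu (by omega), map_zero]

/-- Summing over `δ` convolves the two creation exponentials, and grouping `(m, n)` by `m + n`
convolves the annihilation ones; `expCoeff_add` then merges each pair. -/
theorem oscField_mul_oscField (hd : ∀ n, 0 < n → Lowers n (d n))
    (hd' : ∀ n, 0 < n → Lowers n (d' n))
    (hcc : ∀ i j, 0 < i → 0 < j → Commute (c i) (c' j))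
    (hdd : ∀ i j, 0 < i → 0 < j → Commute (d i) (d' j))
    (hdc : ∀ i j, 0 < i → 0 < j → Commute (d i) (c' j)) (η : ℂ) (u : Fock) :
    {δ : ℂ | oscField c d δ (oscField c' d' (η - δ) u) ≠ 0}.Finite ∧
      ∑ᶠ δ : ℂ, oscField c d δ (oscField c' d' (η - δ) u)
        = oscField (c + c') (d + d') η u := by
  obtain ⟨N, hu⟩ := exists_mem_degreeLE u
  have hfin : ∀ (m : ℂ) (η : ℂ) (x : Fock), (Function.support fun δ : ℂ =>
      (natExtend (expCoeff c) (δ + m) * natExtend (expCoeff c') (η - (δ + m))) x).Finite := by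
    intro m η x
    refine ((natExtend_mul_finite (expCoeff c) (expCoeff c') η).preimage
      (f := fun δ => δ + m) (add_left_injective m).injOn).subset fun δ hδ => ?_
    intro h0
    exact hδ (by simp only [h0, LinearMap.zero_apply])
  have hsum : ∀ (m : ℂ) (η : ℂ) (x : Fock), ∑ᶠ δ : ℂ,
      (natExtend (expCoeff c) (δ + m) * natExtend (expCoeff c') (η - (δ + m))) x
        = natExtend (expCoeff (c + c')) η x := by
    intro m η x
    have hE : expCoeff (c + c')
        = fun n => ∑ p ∈ antidiagonal n, expCoeff c p.1 * expCoeff c' p.2 :=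
      funext fun n => expCoeff_add hcc n
    rw [hE, ← finsum_natExtend_mul]
    have := (LinearMap.applyₗ (R := ℂ) (M₂ := Fock) x).toAddMonoidHom.map_finsum
      (natExtend_mul_finite (expCoeff c) (expCoeff c') η)
    refine Eq.trans ?_ this.symm
    -- The sum runs over all of `ℂ`, so the translation by `m` is harmless.
    exact finsum_comp_equiv (Equiv.addRight m)
      (f := fun δ => (natExtend (expCoeff c) δ * natExtend (expCoeff c') (η - δ)) x)
  simp only [oscField_oscField_apply hd hd' hdd hdc hu]
  constructor
  · refine (Set.Finite.biUnion (range (N + 1)).finite_toSet fun m _ =>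
      Set.Finite.biUnion (range (N + 1)).finite_toSet fun n _ =>
        hfin m (η + m + n) (expCoeff d' n (expCoeff d m u))).subset fun δ hδ => ?_
    obtain ⟨m, hm, hδ⟩ := Finset.exists_ne_zero_of_sum_ne_zero hδ
    obtain ⟨n, hn, hδ⟩ := Finset.exists_ne_zero_of_sum_ne_zero hδ
    simp only [Set.mem_iUnion]
    exact ⟨m, hm, n, hn, hδ⟩
  · rw [finsum_sum_comm]
    · have : ∀ m ∈ range (N + 1), ∑ᶠ δ : ℂ, ∑ n ∈ range (N + 1),
          (natExtend (expCoeff c) (δ + m) * natExtend (expCoeff c') (η + m + n - (δ + m)))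
            (expCoeff d' n (expCoeff d m u))
          = ∑ n ∈ range (N + 1), natExtend (expCoeff (c + c')) (η + (m + n : ℕ))
            (expCoeff d' n (expCoeff d m u)) := by
        intro m _
        rw [finsum_sum_comm _ _ fun n _ => hfin _ _ _]
        refine Finset.sum_congr rfl fun n _ => ?_
        rw [hsum, Nat.cast_add, add_assoc]
      rw [Finset.sum_congr rfl this, sum_range_sum_range_eq_sum_antidiagonal
        (fun m n => natExtend (expCoeff (c + c')) (η + (m + n : ℕ))
          (expCoeff d' n (expCoeff d m u))), oscField_apply (c + c') (K := N + 1)]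
      · refine Finset.sum_congr rfl fun k _ => ?_
        rw [expCoeff_add hdd, LinearMap.sum_apply, map_sum]
        refine Finset.sum_congr rfl fun p hp => ?_
        rw [HasAntidiagonal.mem_antidiagonal.1 hp, (commute_expCoeff hdd _ _).eq]
        rfl
      · exact fun n hn => (hd n hn).add (hd' n hn)
      · exact fun n hn => expCoeff_apply_eq_zero (fun n hn => (hd n hn).add (hd' n hn)) hu
          (by omega)
      · intro m n h
        rw [lowers_mul_apply_eq_zero hd hd' hu (by omega), map_zero]
    · intro m _
      refine (Set.Finite.biUnion (range (N + 1)).finite_toSet fun n _ =>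
        hfin m (η + m + n) (expCoeff d' n (expCoeff d m u))).subset fun δ hδ => ?_
      obtain ⟨n, hn, hδ⟩ := Finset.exists_ne_zero_of_sum_ne_zero hδ
      simp only [Set.mem_iUnion]
      exact ⟨n, hn, hδ⟩

end Product

end ScreeningLimit

end

noncomputable section

namespace ScreeningLimit

open Finset

/-! ### Vertex operators on a single weight -/

theorem constField_mul_finite (A : Module.End ℂ Fock) (B : FormalField) (γ : ℂ) (v : Fock) :
    {δ : ℂ | constField A δ (B (γ - δ) v) ≠ 0}.Finite := by
  refine (Set.finite_singleton (0 : ℂ)).subset fun δ hδ => ?_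
  by_contra h
  exact hδ (by rw [constField, Pi.single_eq_of_ne h, LinearMap.zero_apply])

theorem constField_mul_apply (A : Module.End ℂ Fock) (B : FormalField) (γ : ℂ) (v : Fock) :
    fieldMul (constField A) B γ v = A (B γ v) := by
  rw [fieldMul_apply (constField_mul_finite A B γ), finsum_eq_single _ (0 : ℂ)]
  · rw [sub_zero, constField, Pi.single_eq_same]
  · intro δ h
    rw [constField, Pi.single_eq_of_ne h, LinearMap.zero_apply]

/-- The vectors of the summand of weight `p`. -/
def HasWeight (p : ℂ × ℂ) (v : Fock) : Prop := ∀ f : ℂ × ℂ → ℂ, onWeight f v = f p • v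

theorem hasWeight_single (p : ℂ × ℂ) (x : Osc) : HasWeight p (Finsupp.single p x) := fun f =>
  onWeight_single f p x

theorem HasWeight.map {p : ℂ × ℂ} {v : Fock} (hv : HasWeight p v) {T : Module.End ℂ Fock}
    (hT : ∀ f, Commute T (onWeight f)) : HasWeight p (T v) := fun f => by
  have := LinearMap.congr_fun (hT f).eq v
  rw [Module.End.mul_apply, Module.End.mul_apply, hv f, map_smul] at this
  exact this.symm

/-- The pairing of `x a_0 + y ã_0` with a weight. -/
def zeroPairing (Z p : ℂ × ℂ) : ℂ := Z.1 * p.1 + Z.2 * p.2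

theorem vertexOp_term {c d : ℕ → Module.End ℂ Fock} (Q Z : ℂ × ℂ) {p : ℂ × ℂ} {v : Fock}
    (hv : HasWeight p v) (γ δ : ℂ) :
    oscField c d δ (fieldMul (constField (expShift Q)) (zPow Z) (γ - δ) v)
      = if δ = γ - zeroPairing Z p then oscField c d δ (expShift Q v) else 0 := by
  classical
  have h : zPow Z (γ - δ) v = (if zeroPairing Z p = γ - δ then (1 : ℂ) else 0) • v := by
    rw [zPow, hv]
    congr
  rw [constField_mul_apply, h, map_smul, map_smul, ite_smul, one_smul, zero_smul]
  refine if_congr ?_ rfl rfl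
  rw [eq_sub_iff_add_eq, eq_sub_iff_add_eq, add_comm]

/-- On a weight vector `z^Z` is a single power of `z`, so only one `δ` survives. It acts before the
shift, whence the pairing with `p` and not `p + Q`. -/
theorem vertexOp_apply (c d : ℕ → Module.End ℂ Fock) (Q Z : ℂ × ℂ) {p : ℂ × ℂ} {v : Fock}
    (hv : HasWeight p v) (γ : ℂ) :
    vertexOp c d Q Z γ v = oscField c d (γ - zeroPairing Z p) (expShift Q v) := by
  have hfin : ∀ w : Fock, {δ : ℂ | oscField c d δ
      (fieldMul (constField (expShift Q)) (zPow Z) (γ - δ) w) ≠ 0}.Finite := by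
    refine finite_ne_zero_of_single (T := fun δ => oscField c d δ *
      fieldMul (constField (expShift Q)) (zPow Z) (γ - δ)) fun p x => ?_
    refine (Set.finite_singleton (γ - zeroPairing Z p)).subset fun δ hδ => ?_
    by_contra h
    refine hδ ?_
    rw [Module.End.mul_apply, vertexOp_term Q Z (hasWeight_single p x)]
    exact if_neg h
  refine (fieldMul_apply hfin v).trans ?_
  simp only [vertexOp_term Q Z hv]
  rw [finsum_eq_single _ (γ - zeroPairing Z p) fun δ h => if_neg h, if_pos rfl]

/-- `posSeries` discards the index `0`, where the mode formulas hold only default values such as `t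
/ 0`. -/
theorem vertexOp_congr {c c' d d' : ℕ → Module.End ℂ Fock} (hc : ∀ n, 0 < n → c n = c' n)
    (hd : ∀ n, 0 < n → d n = d' n) (Q Z : ℂ × ℂ) : vertexOp c d Q Z = vertexOp c' d' Q Z := by
  have h1 : expCreate c = expCreate c' := by rw [expCreate, expCreate, posSeries_congr hc]
  have h2 : expAnnihilate d = expAnnihilate d' := by
    rw [expAnnihilate, expAnnihilate, posSeries_congr hd]
  rw [vertexOp, vertexOp, h1, h2]

section Product

variable {c d c' d' : ℕ → Module.End ℂ Fock}

/-- Nothing is contracted: the oscillators commute as required, and `hZ` says that moving `z^Z` past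
`e^{Q'}` produces no power of `z`. -/
theorem vertexOp_mul_vertexOp
    (hd : ∀ n, 0 < n → Lowers n (d n)) (hd' : ∀ n, 0 < n → Lowers n (d' n))
    (hcc : ∀ i j, 0 < i → 0 < j → Commute (c i) (c' j))
    (hdd : ∀ i j, 0 < i → 0 < j → Commute (d i) (d' j))
    (hdc : ∀ i j, 0 < i → 0 < j → Commute (d i) (c' j))
    (hcW : ∀ n, 0 < n → ∀ f, Commute (c' n) (onWeight f))
    (hdW : ∀ n, 0 < n → ∀ f, Commute (d' n) (onWeight f))
    (hcS : ∀ n, 0 < n → ∀ q, Commute (c' n) (expShift q))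
    (hdS : ∀ n, 0 < n → ∀ q, Commute (d' n) (expShift q))
    {Q Q' Z Z' : ℂ × ℂ} (hZ : zeroPairing Z Q' = 0) (γ : ℂ) (v : Fock) :
    {δ : ℂ | vertexOp c d Q Z δ (vertexOp c' d' Q' Z' (γ - δ) v) ≠ 0}.Finite ∧
      ∑ᶠ δ : ℂ, vertexOp c d Q Z δ (vertexOp c' d' Q' Z' (γ - δ) v)
        = vertexOp (c + c') (d + d') (Q + Q') (Z + Z') γ v := by
  have key : ∀ (p : ℂ × ℂ) (x : Osc) (δ : ℂ),
      vertexOp c d Q Z δ (vertexOp c' d' Q' Z' (γ - δ) (Finsupp.single p x))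
        = oscField c d (δ + -zeroPairing Z p) (oscField c' d'
          (γ - zeroPairing (Z + Z') p - (δ + -zeroPairing Z p))
            (Finsupp.single (p + (Q + Q')) x)) := by
    intro p x δ
    have hw : HasWeight (p + Q') (oscField c' d' (γ - δ - zeroPairing Z' p)
        (Finsupp.single (p + Q') x)) :=
      (hasWeight_single _ _).map fun f => (commute_oscField hd'
        (fun n hn => (hcW n hn f).symm) (fun n hn => (hdW n hn f).symm) _).symm
    rw [vertexOp_apply c' d' Q' Z' (hasWeight_single p x), expShift_single,
      vertexOp_apply c d Q Z hw, ← Module.End.mul_apply (expShift Q),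
      (commute_oscField hd' (fun n hn => (hcS n hn Q).symm)
        (fun n hn => (hdS n hn Q).symm) _).eq, Module.End.mul_apply, expShift_single]
    have h1 : zeroPairing Z (p + Q') = zeroPairing Z p := by
      rw [← add_zero (zeroPairing Z p), ← hZ]
      simp only [zeroPairing, Prod.fst_add, Prod.snd_add]
      ring
    have h2 : γ - δ - zeroPairing Z' p
        = γ - zeroPairing (Z + Z') p - (δ + -zeroPairing Z p) := by
      simp only [zeroPairing, Prod.fst_add, Prod.snd_add]
      ring
    rw [h1, h2, sub_eq_add_neg δ, add_assoc p, add_comm Q']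
  have hprod := oscField_mul_oscField (c := c) (c' := c') hd hd' hcc hdd hdc
  have hfin : ∀ p x, {δ : ℂ | vertexOp c d Q Z δ
      (vertexOp c' d' Q' Z' (γ - δ) (Finsupp.single p x)) ≠ 0}.Finite := by
    intro p x
    simp only [key]
    exact (hprod (γ - zeroPairing (Z + Z') p) (Finsupp.single (p + (Q + Q')) x)).1.preimage
      (f := fun δ => δ + -zeroPairing Z p) (add_left_injective _).injOn
  have hfin' : ∀ v, {δ : ℂ | vertexOp c d Q Z δ
      (vertexOp c' d' Q' Z' (γ - δ) v) ≠ 0}.Finite :=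
    finite_ne_zero_of_single (T := fun δ => vertexOp c d Q Z δ * vertexOp c' d' Q' Z' (γ - δ))
      hfin
  refine ⟨hfin' v, ?_⟩
  induction v using Finsupp.induction_linear with
  | zero => simp
  | add v w hv hw =>
    simp only [map_add]
    rw [finsum_add_distrib (hfin' v) (hfin' w), hv, hw]
  | single p x =>
    simp only [key]
    rw [vertexOp_apply _ _ _ _ (hasWeight_single p x), expShift_single, ← (hprod _ _).2]
    exact finsum_comp_equiv (Equiv.addRight (-zeroPairing Z p))
      (f := fun δ => oscField c d δ (oscField c' d' (γ - zeroPairing (Z + Z') p - δ)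
        (Finsupp.single (p + (Q + Q')) x)))

end Product

/-! ### The undeformed current as a difference of two vertex operators. -/

theorem smul_sub_fieldMul {A B C : FormalField} (s : ℂ)
    (hA : ∀ γ v, {δ : ℂ | A δ (C (γ - δ) v) ≠ 0}.Finite)
    (hB : ∀ γ v, {δ : ℂ | B δ (C (γ - δ) v) ≠ 0}.Finite) :
    fieldMul (s • (A - B)) C = s • (fieldMul A C - fieldMul B C) := by
  funext γ
  refine LinearMap.ext fun v => ?_
  -- Linearity of `fieldMul` needs finiteness of every product involved; otherwise the default
  -- coefficient `0` could intervene.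
  have h : ∀ w, {δ : ℂ | (s • (A - B)) δ (C (γ - δ) w) ≠ 0}.Finite := by
    intro w
    refine ((hA γ w).union (hB γ w)).subset fun δ hδ => ?_
    by_contra hcon
    simp only [Set.mem_union, Set.mem_ofPred_eq, not_or, not_not] at hcon
    refine hδ ?_
    rw [Pi.smul_apply, Pi.sub_apply, LinearMap.smul_apply, LinearMap.sub_apply, hcon.1, hcon.2,
      sub_zero, smul_zero]
  rw [fieldMul_apply h, Pi.smul_apply, Pi.sub_apply, LinearMap.smul_apply, LinearMap.sub_apply,
    fieldMul_apply (hA γ), fieldMul_apply (hB γ), ← finsum_sub_distrib (hA γ v) (hB γ v),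
    smul_finsum' s]
  · rfl
  · refine ((hA γ v).union (hB γ v)).subset fun δ hδ => ?_
    by_contra hcon
    simp only [Set.mem_union, Set.mem_ofPred_eq, not_or, not_not] at hcon
    exact hδ (by simp only [hcon.1, hcon.2, sub_zero])

/-- The creation modes `x_n a_{-n} + y_n ã_{-n}`. -/
def creators (x y : ℕ → ℂ) (n : ℕ) : Module.End ℂ Fock := x n • a (-n) + y n • aTilde (-n)

/-- The annihilation modes `x_n a_n + y_n ã_n`. -/
def annihilators (x y : ℕ → ℂ) (n : ℕ) : Module.End ℂ Fock := x n • a n + y n • aTilde n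

theorem lowers_annihilators (x y : ℕ → ℂ) {n : ℕ} (hn : 0 < n) :
    Lowers n (annihilators x y n) :=
  ((lowers_mode false hn).smul _).add ((lowers_mode true hn).smul _)

theorem normalExp_mul_normalExpTilde (s t γ : ℂ) (v : Fock) :
    {δ : ℂ | normalExp s δ (normalExpTilde t (γ - δ) v) ≠ 0}.Finite ∧
      ∑ᶠ δ : ℂ, normalExp s δ (normalExpTilde t (γ - δ) v)
        = vertexOp (creators (fun n => s / n) fun n => t / n)
          (annihilators (fun n => -(s / n)) fun n => -(t / n)) (s, t) (s, t) γ v := by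
  have h := vertexOp_mul_vertexOp (c := fun n : ℕ => (s / n) • a (-n))
    (d := fun n : ℕ => (-(s / n)) • a n) (c' := fun n : ℕ => (t / n) • aTilde (-n))
    (d' := fun n : ℕ => (-(t / n)) • aTilde n)
    (fun n hn => (lowers_mode false hn).smul _) (fun n hn => (lowers_mode true hn).smul _)
    (fun i j hi hj => ((mode_neg_commute _ _ hi hj).smul_right _).smul_left _)
    (fun i j hi hj => ((mode_pos_commute _ _ hi hj).smul_right _).smul_left _)
    (fun i j hi hj => ((mode_pos_commute_mode_neg (by simp) hi hj).smul_right _).smul_left _)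
    (fun n hn f => (mode_commute_onWeight _ (by omega) f).smul_left _)
    (fun n hn f => (mode_commute_onWeight _ (by omega) f).smul_left _)
    (fun n hn f => (mode_commute_expShift _ (by omega) f).smul_left _)
    (fun n hn f => (mode_commute_expShift _ (by omega) f).smul_left _)
    (Q := (s, 0)) (Q' := (0, t)) (Z := (s, 0)) (Z' := (0, t)) (by simp [zeroPairing]) γ v
  refine ⟨h.1, h.2.trans ?_⟩
  rw [Prod.mk_add_mk, add_zero, zero_add]
  rfl

theorem fermion_mul_normalExpTilde (r t : ℂ) :
    fieldMul (fermion r) (normalExpTilde t)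
      = r⁻¹ • (vertexOp (creators (fun n => 1 / n) fun n => t / n)
          (annihilators (fun n => -(1 / n)) fun n => -(t / n)) (1, t) (1, t)
        - vertexOp (creators (fun n => -1 / n) fun n => t / n)
          (annihilators (fun n => -(-1 / n)) fun n => -(t / n)) (-1, t) (-1, t)) := by
  rw [fermion, smul_sub_fieldMul _ (fun γ v => (normalExp_mul_normalExpTilde 1 t γ v).1)
    (fun γ v => (normalExp_mul_normalExpTilde (-1) t γ v).1)]
  congr 2 <;>
  · funext γ
    refine LinearMap.ext fun v => ?_
    rw [fieldMul_apply fun v => (normalExp_mul_normalExpTilde _ t γ v).1,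
      (normalExp_mul_normalExpTilde _ t γ v).2]

end ScreeningLimit

end

noncomputable section

namespace ScreeningLimit

open Finset Filter Topology

/-! ### Convergence within finite-dimensional subspaces -/

/-- `f` is a finite sum `∑ g_i(ħ) w_i` with scalar functions `g_i` that converge as `ħ → 0`, and `w`
is its limit. -/
inductive VecTendsto : (ℂ → Fock) → Fock → Prop
  | smul {g : ℂ → ℂ} {s : ℂ} (w : Fock) (h : Tendsto g (𝓝[≠] 0) (𝓝 s)) :
      VecTendsto (fun hbar => g hbar • w) (s • w)
  | add {f f' : ℂ → Fock} {w w' : Fock} (hf : VecTendsto f w) (hf' : VecTendsto f' w') :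
      VecTendsto (fun hbar => f hbar + f' hbar) (w + w')

/-- Convergence in the sense of `VecTendsto` on every vector. -/
def OpTendsto (T : ℂ → Module.End ℂ Fock) (U : Module.End ℂ Fock) : Prop :=
  ∀ v, VecTendsto (fun hbar => T hbar v) (U v)

theorem VecTendsto.const (w : Fock) : VecTendsto (fun _ => w) w := by
  simpa using VecTendsto.smul w (tendsto_const_nhds (x := (1 : ℂ)))

theorem VecTendsto.tendsto {f : ℂ → Fock} {w : Fock} (h : VecTendsto f w) (l : Fock →ₗ[ℂ] ℂ) :
    Tendsto (fun hbar => l (f hbar)) (𝓝[≠] 0) (𝓝 (l w)) := by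
  induction h with
  | smul w h => simpa using h.mul_const (l w)
  | add _ _ hf hf' => simpa using hf.add hf'

theorem VecTendsto.smul_fun {f : ℂ → Fock} {w : Fock} (h : VecTendsto f w) {g : ℂ → ℂ} {s : ℂ}
    (hg : Tendsto g (𝓝[≠] 0) (𝓝 s)) : VecTendsto (fun hbar => g hbar • f hbar) (s • w) := by
  induction h with
  | smul w h => simpa only [smul_smul] using VecTendsto.smul w (hg.mul h)
  | add _ _ hf hf' => simpa only [smul_add] using hf.add hf'

/-- This is what the finite-sum form of `VecTendsto` buys: the moving argument uses finitely many
fixed vectors, so pointwise convergence of `T` suffices and no topology on the Fock module is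
needed. -/
theorem OpTendsto.apply {T : ℂ → Module.End ℂ Fock} {U : Module.End ℂ Fock} (hT : OpTendsto T U)
    {f : ℂ → Fock} {w : Fock} (h : VecTendsto f w) :
    VecTendsto (fun hbar => T hbar (f hbar)) (U w) := by
  induction h with
  | smul w h => simpa only [map_smul] using (hT w).smul_fun h
  | add _ _ hf hf' => simpa only [map_add] using hf.add hf'

theorem vecTendsto_sum {ι : Type*} (s : Finset ι) {f : ι → ℂ → Fock} {w : ι → Fock}
    (h : ∀ i ∈ s, VecTendsto (f i) (w i)) :
    VecTendsto (fun hbar => ∑ i ∈ s, f i hbar) (∑ i ∈ s, w i) := by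
  classical
  induction s using Finset.induction_on with
  | empty => simpa using VecTendsto.const 0
  | insert i s hi ih =>
    simp only [Finset.sum_insert hi]
    exact (h i (Finset.mem_insert_self i s)).add
      (ih fun j hj => h j (Finset.mem_insert_of_mem hj))

theorem opTendsto_const (U : Module.End ℂ Fock) : OpTendsto (fun _ => U) U :=
  fun v => VecTendsto.const (U v)

theorem OpTendsto.add {T T' : ℂ → Module.End ℂ Fock} {U U' : Module.End ℂ Fock}
    (h : OpTendsto T U) (h' : OpTendsto T' U') :
    OpTendsto (fun hbar => T hbar + T' hbar) (U + U') := fun v => (h v).add (h' v)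

theorem OpTendsto.smul_fun {T : ℂ → Module.End ℂ Fock} {U : Module.End ℂ Fock}
    (h : OpTendsto T U) {g : ℂ → ℂ} {s : ℂ} (hg : Tendsto g (𝓝[≠] 0) (𝓝 s)) :
    OpTendsto (fun hbar => g hbar • T hbar) (s • U) := fun v => (h v).smul_fun hg

theorem OpTendsto.mul {T T' : ℂ → Module.End ℂ Fock} {U U' : Module.End ℂ Fock}
    (h : OpTendsto T U) (h' : OpTendsto T' U') :
    OpTendsto (fun hbar => T hbar * T' hbar) (U * U') := fun v => h.apply (h' v)

theorem opTendsto_sum {ι : Type*} (s : Finset ι) {T : ι → ℂ → Module.End ℂ Fock}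
    {U : ι → Module.End ℂ Fock} (h : ∀ i ∈ s, OpTendsto (T i) (U i)) :
    OpTendsto (fun hbar => ∑ i ∈ s, T i hbar) (∑ i ∈ s, U i) := fun v => by
  simpa only [LinearMap.sum_apply] using vecTendsto_sum s fun i hi => h i hi v

theorem opTendsto_expCoeff {c : ℂ → ℕ → Module.End ℂ Fock} {c₀ : ℕ → Module.End ℂ Fock}
    (hc : ∀ n, 0 < n → OpTendsto (fun hbar => c hbar n) (c₀ n)) (m : ℕ) :
    OpTendsto (fun hbar => expCoeff (c hbar) m) (expCoeff c₀ m) := by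
  have hpow : ∀ k m, OpTendsto (fun hbar => PowerSeries.coeff m (posSeries (c hbar) ^ k))
      (PowerSeries.coeff m (posSeries c₀ ^ k)) := by
    intro k
    induction k with
    | zero =>
      intro m
      simp only [pow_zero]
      exact opTendsto_const _
    | succ k ih =>
      intro m
      simp only [pow_succ, PowerSeries.coeff_mul]
      refine opTendsto_sum _ fun p _ => (ih _).mul ?_
      simp only [coeff_posSeries]
      split_ifs with h
      · exact opTendsto_const _
      · exact hc _ (Nat.pos_of_ne_zero h)
  simp only [expCoeff, expSeries, PowerSeries.coeff_mk]
  exact opTendsto_sum _ fun k _ => (hpow k m).smul_fun tendsto_const_nhds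

theorem opTendsto_natExtend {f : ℂ → ℕ → Module.End ℂ Fock} {f₀ : ℕ → Module.End ℂ Fock}
    (h : ∀ n, OpTendsto (fun hbar => f hbar n) (f₀ n)) (γ : ℂ) :
    OpTendsto (fun hbar => natExtend (f hbar) γ) (natExtend f₀ γ) := by
  by_cases hγ : ∃ k : ℕ, (k : ℂ) = γ
  · obtain ⟨k, rfl⟩ := hγ
    simpa only [natExtend_natCast] using h k
  · push Not at hγ
    simp only [fun f => natExtend_of_ne f hγ]
    exact opTendsto_const 0

/-- The lowering hypothesis holds for every `ħ`, so one truncation `N + 1` serves the whole family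
and its limit. -/
theorem opTendsto_oscField {c d : ℂ → ℕ → Module.End ℂ Fock} {c₀ d₀ : ℕ → Module.End ℂ Fock}
    (hc : ∀ n, 0 < n → OpTendsto (fun hbar => c hbar n) (c₀ n))
    (hd : ∀ n, 0 < n → OpTendsto (fun hbar => d hbar n) (d₀ n))
    (hl : ∀ hbar n, 0 < n → Lowers n (d hbar n)) (hl₀ : ∀ n, 0 < n → Lowers n (d₀ n)) (γ : ℂ) :
    OpTendsto (fun hbar => oscField (c hbar) (d hbar) γ) (oscField c₀ d₀ γ) := by
  intro v
  obtain ⟨N, hN⟩ := exists_mem_degreeLE v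
  rw [oscField_apply c₀ hl₀ (K := N + 1) fun m hm => expCoeff_apply_eq_zero hl₀ hN (by omega)]
  simp only [fun hbar => oscField_apply (c hbar) (hl hbar) (K := N + 1)
    (fun m hm => expCoeff_apply_eq_zero (hl hbar) hN (by omega)) γ]
  exact vecTendsto_sum _ fun m _ =>
    (opTendsto_natExtend (opTendsto_expCoeff hc) _).apply (opTendsto_expCoeff hd m v)

theorem opTendsto_vertexOp {x y x' y' : ℂ → ℕ → ℂ} {x₀ y₀ x₀' y₀' : ℕ → ℂ}
    (hx : ∀ n, 0 < n → Tendsto (fun hbar => x hbar n) (𝓝[≠] 0) (𝓝 (x₀ n)))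
    (hy : ∀ n, 0 < n → Tendsto (fun hbar => y hbar n) (𝓝[≠] 0) (𝓝 (y₀ n)))
    (hx' : ∀ n, 0 < n → Tendsto (fun hbar => x' hbar n) (𝓝[≠] 0) (𝓝 (x₀' n)))
    (hy' : ∀ n, 0 < n → Tendsto (fun hbar => y' hbar n) (𝓝[≠] 0) (𝓝 (y₀' n)))
    (Q Z : ℂ × ℂ) (γ : ℂ) :
    OpTendsto (fun hbar => vertexOp (creators (x hbar) (y hbar))
        (annihilators (x' hbar) (y' hbar)) Q Z γ)
      (vertexOp (creators x₀ y₀) (annihilators x₀' y₀') Q Z γ) := by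
  intro v
  induction v using Finsupp.induction_linear with
  | zero => simpa using VecTendsto.const 0
  | add v w hv hw => simpa only [map_add] using hv.add hw
  | single p f =>
    simp only [vertexOp_apply _ _ _ _ (hasWeight_single p f)]
    exact opTendsto_oscField
      (fun n hn => ((opTendsto_const _).smul_fun (hx n hn)).add
        ((opTendsto_const _).smul_fun (hy n hn)))
      (fun n hn => ((opTendsto_const _).smul_fun (hx' n hn)).add
        ((opTendsto_const _).smul_fun (hy' n hn)))
      (fun _ _ hn => lowers_annihilators _ _ hn) (fun _ hn => lowers_annihilators _ _ hn) _ _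

/-! ### The scalar limits -/

/-- The number `c` with `s_± = e^{c ħ}`. -/
def sRate (β : ℂ) : Sgn → ℂ
  | .plus => -β
  | .minus => 1

theorem sPow_eq (β hbar : ℂ) (e : Sgn) (x : ℂ) :
    sPow β hbar e x = Complex.exp (x * (sRate β e * hbar)) := by
  cases e <;> simp [sPow, sRate, q3Pow, q1Pow]

theorem tendsto_exp_mul (x c : ℂ) :
    Tendsto (fun hbar : ℂ => Complex.exp (x * (c * hbar))) (𝓝[≠] 0) (𝓝 1) := by
  have h : Continuous fun hbar : ℂ => Complex.exp (x * (c * hbar)) := by fun_prop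
  simpa using (h.tendsto 0).mono_left nhdsWithin_le_nhds

/-- The quotient is the slope at `0` of a function vanishing there, so its limit is the derivative.
-/
theorem tendsto_one_sub_exp_div (x c : ℂ) :
    Tendsto (fun hbar : ℂ => (1 - Complex.exp (x * (c * hbar))) / hbar) (𝓝[≠] 0)
      (𝓝 (-(x * c))) := by
  have h : HasDerivAt (fun hbar : ℂ => 1 - Complex.exp (x * (c * hbar))) (-(x * c)) 0 := by
    have h1 : HasDerivAt (fun hbar : ℂ => x * (c * hbar)) (x * c) 0 := by
      simpa using ((hasDerivAt_id (0 : ℂ)).const_mul c).const_mul x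
    simpa using h1.cexp.const_sub 1
  have := h.tendsto_slope
  refine this.congr fun hbar => ?_
  simp [slope_def_field]

section Scalars

variable {β b : ℂ} (e : Sgn) {n : ℕ}

theorem tendsto_q1Pow (x : ℂ) : Tendsto (fun hbar => q1Pow hbar x) (𝓝[≠] 0) (𝓝 1) := by
  simpa [q1Pow] using tendsto_exp_mul x 1

theorem tendsto_q2Pow (β x : ℂ) : Tendsto (fun hbar => q2Pow β hbar x) (𝓝[≠] 0) (𝓝 1) :=
  tendsto_exp_mul x (β - 1)

theorem tendsto_q3Pow (β x : ℂ) : Tendsto (fun hbar => q3Pow β hbar x) (𝓝[≠] 0) (𝓝 1) :=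
  tendsto_exp_mul x (-β)

theorem tendsto_qPow (β x : ℂ) : Tendsto (fun hbar => qPow β hbar x) (𝓝[≠] 0) (𝓝 1) := by
  refine (tendsto_exp_mul x ((β - 1) / 2)).congr fun hbar => ?_
  rw [qPow]
  congr 1
  ring

theorem tendsto_sPow (β x : ℂ) : Tendsto (fun hbar => sPow β hbar e x) (𝓝[≠] 0) (𝓝 1) := by
  simpa only [sPow_eq] using tendsto_exp_mul x (sRate β e)

theorem sRate_ne_zero (hβ : β ≠ 0) : sRate β e ≠ 0 := by
  cases e <;> simp [sRate, hβ]

/-- The pole comes from `1 - s^{2n} ~ -2n c ħ` with `c = sRate β e`; all other factors tend to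
constants, and the `2` from `1 + q_2^n` cancels. -/
theorem tendsto_screeningCoeff_mul (hβ : β ≠ 0) (hn : 0 < n) :
    Tendsto (fun hbar => screeningCoeff β hbar e n * hbar) (𝓝[≠] 0)
      (𝓝 (-1 / (n ^ 2 * sRate β e))) := by
  have hn' : (n : ℂ) ≠ 0 := by exact_mod_cast hn.ne'
  have hs := sRate_ne_zero e hβ
  have h1 : Tendsto (fun hbar => (1 - sPow β hbar e (2 * n)) / hbar) (𝓝[≠] 0)
      (𝓝 (-(2 * n * sRate β e))) := by
    simpa only [sPow_eq] using tendsto_one_sub_exp_div (2 * n) (sRate β e)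
  have h := (((tendsto_sPow e β (n / 2)).mul ((tendsto_q2Pow β n).const_add 1)).div
    ((tendsto_qPow β n).const_mul (n : ℂ)) (by simpa using hn')).mul (h1.inv₀ (by simp [hn', hs]))
  convert h using 2
  · simp only [screeningCoeff, div_eq_mul_inv, mul_inv, inv_inv, Pi.div_apply]
    ring
  · field_simp
    norm_num

theorem tendsto_screeningCoeff_mul_of_div (hβ : β ≠ 0) (hn : 0 < n) {g : ℂ → ℂ} {x : ℂ}
    (hg : Tendsto (fun hbar => g hbar / hbar) (𝓝[≠] 0) (𝓝 x)) :
    Tendsto (fun hbar => screeningCoeff β hbar e n * g hbar) (𝓝[≠] 0)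
      (𝓝 (-x / (n ^ 2 * sRate β e))) := by
  have h := (tendsto_screeningCoeff_mul e hβ hn).mul hg
  convert h.congr' ?_ using 2
  · ring
  · filter_upwards [self_mem_nhdsWithin] with hbar h0
    have : hbar ≠ 0 := h0
    field_simp

/-- The coefficient of `a_{-n}` in the deformed screening current `S_1^±`. -/
def deformedX (β : ℂ) (e : Sgn) (hbar : ℂ) (n : ℕ) : ℂ :=
  screeningCoeff β hbar e n * (1 - sPow β hbar e n)

/-- The coefficient of `±a_n` in `λ_{i,n}`. -/
def deformedA (β hbar : ℂ) (n : ℕ) : ℂ :=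
  (1 + q1Pow hbar n) * (1 + q3Pow β hbar n) / (2 * (1 + q2Pow β hbar (-n)))

/-- The coefficient of `ã_{-n}` in the deformed screening currents. -/
def deformedCreate (β b : ℂ) (e : Sgn) (hbar : ℂ) (n : ℕ) : ℂ :=
  screeningCoeff β hbar e n *
    ((1 + sPow β hbar e n) * ((1 - q3Pow β hbar n) / (b * (1 + q2Pow β hbar (-n)))))

/-- The coefficient of `ã_n` in the deformed screening currents. -/
def deformedAnnihilate (β b : ℂ) (e : Sgn) (hbar : ℂ) (n : ℕ) : ℂ :=
  screeningCoeff β hbar e n * ((1 + sPow β hbar e n) * (b / 2 * (1 - q1Pow hbar n)))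

theorem tendsto_deformedX (hβ : β ≠ 0) (hn : 0 < n) :
    Tendsto (fun hbar => deformedX β e hbar n) (𝓝[≠] 0) (𝓝 (1 / n)) := by
  have hn' : (n : ℂ) ≠ 0 := by exact_mod_cast hn.ne'
  have hs := sRate_ne_zero e hβ
  have h : Tendsto (fun hbar => (1 - sPow β hbar e n) / hbar) (𝓝[≠] 0)
      (𝓝 (-(n * sRate β e))) := by
    simpa only [sPow_eq] using tendsto_one_sub_exp_div n (sRate β e)
  convert tendsto_screeningCoeff_mul_of_div e hβ hn h using 2
  · rfl
  · field_simp

theorem tendsto_deformedA (β : ℂ) (n : ℕ) :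
    Tendsto (fun hbar => deformedA β hbar n) (𝓝[≠] 0) (𝓝 1) := by
  have h := (((tendsto_q1Pow n).const_add 1).mul ((tendsto_q3Pow β n).const_add 1)).div
    (((tendsto_q2Pow β (-n)).const_add 1).const_mul 2) (by norm_num)
  convert h using 2
  · rfl
  · norm_num

/-- The limit computes to `-b / (n c)` with `c = sRate β e`. Both signs agree with `tPM`, since `-b
/ c` is `1 / b` for `c = -b²` and `-b` for `c = 1`. -/
theorem tendsto_deformedCreate (hβ : β ≠ 0) (hb : b ^ 2 = β) (hn : 0 < n) :
    Tendsto (fun hbar => deformedCreate β b e hbar n) (𝓝[≠] 0) (𝓝 (tPM b e / n)) := by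
  have hn' : (n : ℂ) ≠ 0 := by exact_mod_cast hn.ne'
  have hb' : b ≠ 0 := by
    rintro rfl
    exact hβ (by rw [← hb]; ring)
  have h1 : Tendsto (fun hbar => (1 - q3Pow β hbar n) / hbar) (𝓝[≠] 0) (𝓝 (-(n * -β))) :=
    tendsto_one_sub_exp_div n (-β)
  have h2 := ((tendsto_sPow e β n).const_add 1).mul (h1.div
    (((tendsto_q2Pow β (-n)).const_add 1).const_mul b) (by simp [hb']))
  have h3 : Tendsto (fun hbar => (1 + sPow β hbar e n) *
      ((1 - q3Pow β hbar n) / (b * (1 + q2Pow β hbar (-n)))) / hbar) (𝓝[≠] 0)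
      (𝓝 ((1 + 1) * (-(n * -β) / (b * (1 + 1))))) := by
    refine h2.congr fun hbar => ?_
    simp only [Pi.div_apply]
    ring
  convert tendsto_screeningCoeff_mul_of_div e hβ hn h3 using 2
  · rfl
  subst hb
  cases e <;> simp only [sRate, tPM] <;> field_simp

theorem tendsto_deformedAnnihilate (hβ : β ≠ 0) (hb : b ^ 2 = β) (hn : 0 < n) :
    Tendsto (fun hbar => deformedAnnihilate β b e hbar n) (𝓝[≠] 0) (𝓝 (-(tPM b e / n))) := by
  have hn' : (n : ℂ) ≠ 0 := by exact_mod_cast hn.ne'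
  have hb' : b ≠ 0 := by
    rintro rfl
    exact hβ (by rw [← hb]; ring)
  have h1 : Tendsto (fun hbar => (1 - q1Pow hbar n) / hbar) (𝓝[≠] 0) (𝓝 (-(n * 1))) := by
    simpa [q1Pow] using tendsto_one_sub_exp_div n 1
  have h2 := ((tendsto_sPow e β n).const_add 1).mul (h1.const_mul (b / 2))
  have h3 : Tendsto (fun hbar => (1 + sPow β hbar e n) * (b / 2 * (1 - q1Pow hbar n)) / hbar)
      (𝓝[≠] 0) (𝓝 ((1 + 1) * (b / 2 * -(n * 1)))) := by
    refine h2.congr fun hbar => ?_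
    ring
  convert tendsto_screeningCoeff_mul_of_div e hβ hn h3 using 2
  · rfl
  subst hb
  cases e <;> simp only [sRate, tPM] <;> field_simp <;> norm_num

end Scalars

/-! ### The deformed screening currents as vertex operators -/

theorem lam1_pos (β b hbar : ℂ) {n : ℕ} (hn : 0 < n) :
    lam1 β b hbar n = deformedA β hbar n • a n + (b / 2 * (1 - q1Pow hbar n)) • aTilde n := by
  rw [lam1, if_pos (by exact_mod_cast hn)]
  simp [deformedA]

theorem lam2_pos (β b hbar : ℂ) {n : ℕ} (hn : 0 < n) :
    lam2 β b hbar n = (-deformedA β hbar n) • a n + (b / 2 * (1 - q1Pow hbar n)) • aTilde n := by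
  rw [lam2, if_pos (by exact_mod_cast hn)]
  simp [deformedA]

theorem lam1_neg (β b hbar : ℂ) {n : ℕ} (hn : 0 < n) :
    lam1 β b hbar (-n)
      = a (-n) + ((1 - q3Pow β hbar n) / (b * (1 + q2Pow β hbar (-n)))) • aTilde (-n) := by
  rw [lam1, if_neg (by omega), if_pos (by omega)]
  simp

theorem lam2_neg (β b hbar : ℂ) {n : ℕ} (hn : 0 < n) :
    lam2 β b hbar (-n)
      = -a (-n) + ((1 - q3Pow β hbar n) / (b * (1 + q2Pow β hbar (-n)))) • aTilde (-n) := by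
  rw [lam2, if_neg (by omega), if_pos (by omega)]
  simp

theorem tau_mul {β b : ℂ} (hb : b ^ 2 = β) (e : Sgn) : tau β e * b = tPM b e := by
  subst hb
  cases e
  · simp only [tau, tPM]
    -- At `b = 0` both sides are `0` under the convention for division by zero.
    rcases eq_or_ne b 0 with rfl | h
    · simp
    · field_simp
  · simp [tau, tPM]

/-- `λ_1` and `λ_2` differ only in the sign of `a`. Thus `λ_1 + s^n λ_2` carries `1 - s^n` on
`a_{-n}`, while `s^n λ_1 + λ_2` carries `-(1 - s^n)` on `a_n`; on `ã` both give `1 + s^n`. -/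
theorem screening1_eq {β b : ℂ} (hb : b ^ 2 = β) (e : Sgn) (hbar : ℂ) :
    screening1 β b hbar e
      = vertexOp (creators (deformedX β e hbar) (deformedCreate β b e hbar))
        (annihilators (fun n => -(deformedX β e hbar n * deformedA β hbar n))
          (deformedAnnihilate β b e hbar)) (1, tPM b e) (1, tPM b e) := by
  have hQ : Q1 + tau β e • Qzeta b = (1, tPM b e) := by
    rw [← tau_mul hb e]
    simp [Q1, Qzeta]
  have hZ : lam1Zero + (2 * tau β e) • zetaZero b = (1, tPM b e) := by
    rw [← tau_mul hb e]
    simp [lam1Zero, zetaZero]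
    ring
  rw [screening1, hQ, hZ]
  apply vertexOp_congr
  · intro n hn
    rw [lam1_neg β b hbar hn, lam2_neg β b hbar hn, creators, deformedX, deformedCreate]
    module
  · intro n hn
    rw [lam1_pos β b hbar hn, lam2_pos β b hbar hn, annihilators, deformedX, deformedAnnihilate]
    module

theorem screening2_eq {β b : ℂ} (hb : b ^ 2 = β) (e : Sgn) (hbar : ℂ) :
    screening2 β b hbar e
      = vertexOp (creators (fun n => -deformedX β e hbar n) (deformedCreate β b e hbar))
        (annihilators (fun n => deformedX β e hbar n * deformedA β hbar n)
          (deformedAnnihilate β b e hbar)) (-1, tPM b e) (-1, tPM b e) := by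
  have hQ : -Q1 + tau β e • Qzeta b = (-1, tPM b e) := by
    rw [← tau_mul hb e]
    simp [Q1, Qzeta]
  have hZ : -lam1Zero + (2 * tau β e) • zetaZero b = (-1, tPM b e) := by
    rw [← tau_mul hb e]
    simp [lam1Zero, zetaZero]
    ring
  rw [screening2, hQ, hZ]
  apply vertexOp_congr
  · intro n hn
    rw [lam1_neg β b hbar hn, lam2_neg β b hbar hn, creators, deformedX, deformedCreate]
    module
  · intro n hn
    rw [lam1_pos β b hbar hn, lam2_pos β b hbar hn, annihilators, deformedX, deformedAnnihilate]
    module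

theorem hasLimitAtZero_screening {β b r : ℂ} (hβ : β ≠ 0) (hb : b ^ 2 = β) (hr : r ≠ 0)
    (e : Sgn) :
    HasLimitAtZero (fun hbar => screening β b hbar e)
      ((r / tPM b e) • superScreening r (tPM b e)) := by
  have ht : tPM b e ≠ 0 := by
    have hb' : b ≠ 0 := by
      rintro rfl
      exact hβ (by rw [← hb]; ring)
    cases e <;> simp [tPM, hb']
  -- The prefactors cancel: `(r / t) · t · r⁻¹ = 1`.
  rw [superScreening, fermion_mul_normalExpTilde, smul_smul, smul_smul,
    div_mul_cancel₀ _ ht, mul_inv_cancel₀ hr, one_smul]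
  intro γ v l
  simp only [screening, screening1_eq hb, screening2_eq hb, Pi.sub_apply, LinearMap.sub_apply,
    map_sub]
  have hX : ∀ n : ℕ, 0 < n → Tendsto (fun hbar => deformedX β e hbar n) (𝓝[≠] 0) (𝓝 (1 / n)) :=
    fun n hn => tendsto_deformedX e hβ hn
  have hXA : ∀ n : ℕ, 0 < n → Tendsto (fun hbar => deformedX β e hbar n * deformedA β hbar n)
      (𝓝[≠] 0) (𝓝 (1 / n)) :=
    fun n hn => by simpa using (hX n hn).mul (tendsto_deformedA β n)
  have hY := fun (n : ℕ) (hn : 0 < n) => tendsto_deformedCreate e hβ hb hn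
  have hY' := fun (n : ℕ) (hn : 0 < n) => tendsto_deformedAnnihilate e hβ hb hn
  refine ((opTendsto_vertexOp hX hY (fun n hn => (hXA n hn).neg) hY' _ _ γ v).tendsto l).sub
    ((opTendsto_vertexOp (fun n hn => ?_) hY (fun n hn => ?_) hY' _ _ γ v).tendsto l)
  · simpa [neg_div] using (hX n hn).neg
  · simpa [neg_div] using hXA n hn

end ScreeningLimit

end

/-! ### The theorem, including the identification of `t_±` with `σ ± √(σ² + 1)`. -/

theorem mainTheorem7 (β b r : ℂ) (hβ : β ≠ 0) (hb : b ^ 2 = β) (hr : r ^ 2 = -2) :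
    (∃ ρ : ℂ, ρ ^ 2 = ((1 - β) / (2 * b)) ^ 2 + 1 ∧
      ScreeningLimit.tPM b .plus = (1 - β) / (2 * b) + ρ ∧
      ScreeningLimit.tPM b .minus = (1 - β) / (2 * b) - ρ) ∧
    ∀ e : ScreeningLimit.Sgn,
      ScreeningLimit.HasLimitAtZero
        (fun hbar => ScreeningLimit.screening β b hbar e)
        ((r / ScreeningLimit.tPM b e) •
          ScreeningLimit.superScreening r (ScreeningLimit.tPM b e)) := by
  have hb' : b ≠ 0 := by
    rintro rfl
    exact hβ (by rw [← hb]; ring)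
  have hr' : r ≠ 0 := by
    rintro rfl
    norm_num at hr
  -- The root comes from `(1 - β)² + 4β = (1 + β)²`, with `b² = β`.
  refine ⟨⟨(1 + β) / (2 * b), ?_, ?_, ?_⟩,
    fun e => ScreeningLimit.hasLimitAtZero_screening hβ hb hr' e⟩
  · subst hb
    field_simp
    ring
  · rw [ScreeningLimit.tPM]
    field_simp
    ring
  · rw [ScreeningLimit.tPM]
    subst hb
    field_simp
    ring
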